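/- Let $0<q<1$ and write $(x;q)_n=\prod_{k=0}^{n-1}(1-xq^k)$, $(x;q)_\infty=\prod_{k=0}^{\infty}(1-xq^k)$, $(x_1,\dots,x_m;q)_n=(x_1;q)_n\cdots(x_m;q)_n$ (for $n$ a nonnegative integer or $\infty$), and $${}_{3}\phi_2\left({x_1,x_2,x_3\atop y_1,y_2};q,z\right)=\sum_{n=0}^\infty\frac{(x_1,x_2,x_3;q)_n}{(q,y_1,y_2;q)_n}z^n .$$ Let $h(x;a|q)=\prod_{k=0}^\infty(1-2q^kax+q^{2k}a^2)$, so that $h(\cos\theta;a|q)=(ae^{i\theta},ae^{-i\theta};q)_\infty$, and $h(x;a_1,\dots,a_m|q)=h(x;a_1|q)\cdots h(x;a_m|q)$. Let $a,b,c,d,r\in\mathbb C$ with $\max\{|a|,|b|,|c|,|d|,|r|\}<1$, let $\alpha=a^2bcdr/q$, assume $\alpha\neq1$, and let $\sqrt{q\alpha}$ be either square root of $q\alpha$. Then the ${}_3\phi_2$ series below converges absolutely for every real $\theta$, the integrand is integrable on $[0,\pi]$, the series on the right converges absolutely, and $$\int_0^\pi\frac{h(\cos2\theta;1|q)}{h(\cos\theta;a,b,c,d,r|q)}\;{}_3\phi_2\left({ae^{i\theta},ae^{-i\theta},0\atop\sqrt{q\alpha},-\sqrt{q\alpha}};q,bcdr\right)d\theta$$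 $$=\frac{2\pi\,(abcd,abcr,abdr,acdr;q)_\infty}{(q,ab,ac,ad,ar,bc,bd,br,cd,cr,dr,a^2bcdr;q)_\infty}\sum_{n=0}^\infty\frac{(1-\alpha q^{4n})(\alpha,ab,ac,ad,ar;q)_{2n}(q;q^2)_n}{(1-\alpha)(q,abcd,abcr,abdr,acdr;q)_{2n}(q\alpha;q^2)_n}(-\alpha)^n(bcdr)^{2n}q^{3n^2-n}.$$ -/

import Mathlib

open Real Filter Topology MeasureTheory BigOperators

noncomputable section

/-- The finite `q`-shifted factorial `(a; q)_n = ∏_{k=0}^{n-1} (1 - a q^k)`. -/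
def qPoch (a q : ℂ) (n : ℕ) : ℂ := ∏ k ∈ Finset.range n, (1 - a * q ^ k)

/-- The infinite `q`-shifted factorial `(a; q)_∞ = ∏_{k=0}^∞ (1 - a q^k)`; the product
converges for `|q| < 1`, see `qPochInf_multipliable`. -/
def qPochInf (a q : ℂ) : ℂ := ∏' k : ℕ, (1 - a * q ^ k)

/-- The multiple `q`-shifted factorial `(a_1, ..., a_m; q)_n`. -/
def qPochs (as : List ℂ) (q : ℂ) (n : ℕ) : ℂ := (as.map fun a => qPoch a q n).prod

/-- The multiple `q`-shifted factorial `(a_1, ..., a_m; q)_∞`. -/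
def qPochsInf (as : List ℂ) (q : ℂ) : ℂ := (as.map fun a => qPochInf a q).prod

/-- The `n`-th term of the basic hypergeometric series
`_{r+1}φ_r (a_1, ..., a_{r+1}; b_1, ..., b_r; q, z)`. -/
def qHyperTerm {r : ℕ} (as : Fin (r + 1) → ℂ) (bs : Fin r → ℂ) (q z : ℂ) (n : ℕ) : ℂ :=
  (∏ i, qPoch (as i) q n) * z ^ n / (qPoch q q n * ∏ j, qPoch (bs j) q n)

/-- The basic hypergeometric series `_{r+1}φ_r (a_1, ..., a_{r+1}; b_1, ..., b_r; q, z)`. -/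
def qHyper {r : ℕ} (as : Fin (r + 1) → ℂ) (bs : Fin r → ℂ) (q z : ℂ) : ℂ :=
  ∑' n : ℕ, qHyperTerm as bs q z n

/-- `h(x; a | q) = ∏_{k=0}^∞ (1 - 2 q^k a x + q^{2k} a^2)`; for `x = cos θ` this is
`(a e^{iθ}, a e^{-iθ}; q)_∞`, see `hProd_cos`. -/
def hProd (x : ℝ) (a q : ℂ) : ℂ := ∏' k : ℕ, (1 - 2 * q ^ k * a * (x : ℂ) + q ^ (2 * k) * a ^ 2)

/-- `h(x; a_1, ..., a_m | q) = h(x; a_1 | q) ⋯ h(x; a_m | q)`. -/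
def hProds (x : ℝ) (as : List ℂ) (q : ℂ) : ℂ := (as.map fun a => hProd x a q).prod

theorem qPochInf_multipliable (a q : ℂ) (hq : ‖q‖ < 1) :
    Multipliable fun k : ℕ => 1 - a * q ^ k := by
  have h : Summable fun k : ℕ => ‖-(a * q ^ k)‖ := by
    simp only [norm_neg, norm_mul, norm_pow]
    exact (summable_geometric_of_lt_one (norm_nonneg _) hq).mul_left _
  simpa [sub_eq_add_neg] using multipliable_one_add_of_summable h

theorem hProd_cos (θ : ℝ) (a q : ℂ) (hq : ‖q‖ < 1) :
    hProd (Real.cos θ) a q =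
      qPochsInf [a * Complex.exp (Complex.I * θ), a * Complex.exp (-(Complex.I * θ))] q := by
  simp only [qPochsInf, List.map_cons, List.map_nil, List.prod_cons, List.prod_nil, mul_one]
  unfold hProd qPochInf
  rw [← (qPochInf_multipliable _ q hq).tprod_mul (qPochInf_multipliable _ q hq)]
  refine tprod_congr fun k => ?_
  have h1 : Complex.exp (Complex.I * θ) * Complex.exp (-(Complex.I * θ)) = 1 := by
    rw [← Complex.exp_add]; simp
  have h2 : 2 * ((Real.cos θ : ℝ) : ℂ)
      = Complex.exp (Complex.I * θ) + Complex.exp (-(Complex.I * θ)) := by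
    rw [Complex.ofReal_cos, Complex.two_cos]
    congr 2 <;> ring
  linear_combination (-(q ^ k * a)) * h2 - q ^ (2 * k) * a ^ 2 * h1

/-- The function of `θ` under the integral sign: the five-parameter weight
`h(cos 2θ; 1 | q) / h(cos θ; a, b, c, d, r | q)` times
`_3φ_2 (a e^{iθ}, a e^{-iθ}, 0; σ, -σ; q, bcdr)`, where `σ` stands for `√(qα)`. -/
def weightedIntegrand (q a b c d r σ : ℂ) (θ : ℝ) : ℂ :=
  hProd (Real.cos (2 * θ)) 1 q / hProds (Real.cos θ) [a, b, c, d, r] q *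
    qHyper ![a * Complex.exp (Complex.I * θ), a * Complex.exp (-(Complex.I * θ)), 0]
      ![σ, -σ] q (b * c * d * r)

/-- The `n`-th term of the series on the right-hand side. -/
def evenSeriesTerm (q a b c d r α : ℂ) (n : ℕ) : ℂ :=
  (1 - α * q ^ (4 * n)) * qPochs [α, a * b, a * c, a * d, a * r] q (2 * n) * qPoch q (q ^ 2) n /
    ((1 - α) * qPochs [q, a * b * c * d, a * b * c * r, a * b * d * r, a * c * d * r] q (2 * n) *
      qPoch (q * α) (q ^ 2) n) *
    (-α) ^ n * (b * c * d * r) ^ (2 * n) * q ^ (3 * n ^ 2 - n)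

end

/-! Write `s = bcdr`, `x = a e^{iθ}`, `y = a e^{-iθ}`, so that `x y s = qα`. Since `(σ, -σ; q)_n =
(qα; q²)_n`, the `₃φ₂` is a series in `β_n = 1 / ((q; q)_n (qα; q²)_n)`. This `β_n` belongs to a
Bailey pair relative to `α` supported on even indices: `β_n = ∑_m A_m / ((q; q)_{n-2m} (αq;
q)_{n+2m})` with `A_m = baileyCoeff q α m` (`sum_baileyCoeff`). Interchanging the sums leaves an
inner sum over `n` that the `q`-Gauss formula evaluates (`hasSum_qGaussTerm`), precisely because `x
y s = qα`; the result is `exists_hasSum_bailey`.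

The `m`-th term of the new series contains `(x, y; q)_{2m}`, which turns `1 / (x, y; q)_∞` in the
weight into the same factor with `a` replaced by `a q^{2m}`. Each term is therefore a constant times
a Nassrallah–Rahman integrand (`hasSum_weightedIntegrand`). Integrating termwise with
`integral_nrWeight` gives the right-hand side.

The Nassrallah–Rahman integral rests on a contiguous relation: a combination of the integrands at
`aq` and at `a` equals a constant times `G(z) - G(z/q)`, with `G` analytic on `1 ≤ |z| ≤ 1/q`, so it
integrates to zero by Cauchy (`nrIntegral_contiguous`). Iteration sends `a` to `0`; by symmetry all
five parameters go to `0` (`nrIntegral_mul_eq`). The remaining constant is found from one choice of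
parameters with an elementary integrand (`nrIntegral_zero`). -/

/-! ### Finite and infinite `q`-shifted factorials: recurrences, uniform bounds, analyticity. -/

section QPochhammer

theorem qPoch_zero (a q : ℂ) : qPoch a q 0 = 1 := by simp [qPoch]

theorem qPoch_succ (a q : ℂ) (n : ℕ) : qPoch a q (n + 1) = qPoch a q n * (1 - a * q ^ n) := by
  simp [qPoch, Finset.prod_range_succ]

theorem qPoch_add (a q : ℂ) (m n : ℕ) :
    qPoch a q (m + n) = qPoch a q m * qPoch (a * q ^ m) q n := by
  simp [qPoch, Finset.prod_range_add, pow_add, mul_assoc]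

theorem qPoch_succ' (a q : ℂ) (n : ℕ) : qPoch a q (n + 1) = (1 - a) * qPoch (a * q) q n := by
  rw [add_comm, qPoch_add]; simp [qPoch]

theorem qPoch_zero_left (q : ℂ) (n : ℕ) : qPoch 0 q n = 1 := by simp [qPoch]

theorem qPochInf_zero_left (q : ℂ) : qPochInf 0 q = 1 := by simp [qPochInf]

theorem continuous_qPoch_left (q : ℂ) (n : ℕ) : Continuous fun a => qPoch a q n := by
  unfold qPoch; fun_prop

theorem norm_mul_pow_lt_one {a q : ℂ} (ha : ‖a‖ < 1) (hq : ‖q‖ < 1) (n : ℕ) :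
    ‖a * q ^ n‖ < 1 := by
  rw [norm_mul, norm_pow]
  exact (mul_le_of_le_one_right (norm_nonneg _) (pow_le_one₀ (norm_nonneg _) hq.le)).trans_lt ha

theorem one_sub_ne_zero_of_norm_lt_one {a : ℂ} (ha : ‖a‖ < 1) : 1 - a ≠ 0 := by
  intro h
  rw [← sub_eq_zero.1 h] at ha
  simp at ha

theorem qPoch_ne_zero {a q : ℂ} (ha : ‖a‖ < 1) (hq : ‖q‖ < 1) (n : ℕ) : qPoch a q n ≠ 0 :=
  Finset.prod_ne_zero_iff.2 fun k _ => one_sub_ne_zero_of_norm_lt_one (norm_mul_pow_lt_one ha hq k)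

theorem qPochInf_ne_zero_of_forall {a q : ℂ} (h : ∀ k : ℕ, 1 - a * q ^ k ≠ 0) (hq : ‖q‖ < 1) :
    qPochInf a q ≠ 0 := by
  have := tprod_one_add_ne_zero_of_summable (f := fun k : ℕ => -(a * q ^ k))
    (fun k => by simpa [sub_eq_add_neg] using h k) (by
      simp only [norm_neg, norm_mul, norm_pow]
      exact (summable_geometric_of_lt_one (norm_nonneg _) hq).mul_left _)
  simpa [qPochInf, sub_eq_add_neg] using this

theorem qPochInf_ne_zero {a q : ℂ} (ha : ‖a‖ < 1) (hq : ‖q‖ < 1) : qPochInf a q ≠ 0 :=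
  qPochInf_ne_zero_of_forall
    (fun k => one_sub_ne_zero_of_norm_lt_one (norm_mul_pow_lt_one ha hq k)) hq

theorem tendsto_qPoch (a : ℂ) {q : ℂ} (hq : ‖q‖ < 1) :
    Tendsto (qPoch a q) atTop (𝓝 (qPochInf a q)) :=
  (qPochInf_multipliable a q hq).hasProd.tendsto_prod_nat

theorem qPochInf_eq_qPoch_mul (a : ℂ) {q : ℂ} (hq : ‖q‖ < 1) (n : ℕ) :
    qPochInf a q = qPoch a q n * qPochInf (a * q ^ n) q := by
  refine tendsto_nhds_unique ((tendsto_add_atTop_iff_nat n).2 (tendsto_qPoch a hq)) ?_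
  simp_rw [add_comm _ n, qPoch_add]
  exact (tendsto_qPoch _ hq).const_mul _

theorem qPochInf_step (a : ℂ) {q : ℂ} (hq : ‖q‖ < 1) :
    qPochInf a q = (1 - a) * qPochInf (a * q) q := by
  simpa [qPoch] using qPochInf_eq_qPoch_mul a hq 1

theorem sum_pow_range_le {x : ℝ} (h0 : 0 ≤ x) (h1 : x < 1) (n : ℕ) :
    ∑ k ∈ Finset.range n, x ^ k ≤ (1 - x)⁻¹ := by
  rw [← tsum_geometric_of_lt_one h0 h1]
  exact (summable_geometric_of_lt_one h0 h1).sum_le_tsum _ fun _ _ => by positivity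

/-- Each factor is at most `exp (ρ |q|^k)`, and the exponents form a geometric series. The bound
does not depend on `n`, which is what the dominated-convergence arguments need. -/
theorem norm_qPoch_le (a : ℂ) {q : ℂ} (hq : ‖q‖ < 1) {ρ : ℝ} (ha : ‖a‖ ≤ ρ) (n : ℕ) :
    ‖qPoch a q n‖ ≤ Real.exp (ρ * (1 - ‖q‖)⁻¹) := by
  have hρ : 0 ≤ ρ := (norm_nonneg _).trans ha
  calc ‖qPoch a q n‖ ≤ ∏ k ∈ Finset.range n, Real.exp (ρ * ‖q‖ ^ k) := by
        rw [qPoch, norm_prod]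
        refine Finset.prod_le_prod (fun _ _ => norm_nonneg _) fun k _ => ?_
        have h1 : ‖1 - a * q ^ k‖ ≤ 1 + ‖a‖ * ‖q‖ ^ k := by
          simpa using norm_sub_le (1 : ℂ) (a * q ^ k)
        have h2 : ‖a‖ * ‖q‖ ^ k ≤ ρ * ‖q‖ ^ k := by gcongr
        linarith [Real.add_one_le_exp (ρ * ‖q‖ ^ k)]
    _ = Real.exp (ρ * ∑ k ∈ Finset.range n, ‖q‖ ^ k) := by
        rw [← Real.exp_sum, Finset.mul_sum]
    _ ≤ _ := by
        gcongr
        exact sum_pow_range_le (norm_nonneg _) hq n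

theorem norm_inv_qPoch_le {a q : ℂ} (hq : ‖q‖ < 1) {ρ : ℝ} (hρ : ρ < 1) (ha : ‖a‖ ≤ ρ) (n : ℕ) :
    ‖(qPoch a q n)⁻¹‖ ≤ Real.exp (ρ / (1 - ρ) * (1 - ‖q‖)⁻¹) := by
  have hρ0 : 0 ≤ ρ := (norm_nonneg _).trans ha
  have hρ1 : 0 < 1 - ρ := by linarith
  calc ‖(qPoch a q n)⁻¹‖ ≤ ∏ k ∈ Finset.range n, Real.exp (ρ / (1 - ρ) * ‖q‖ ^ k) := by
        rw [qPoch, norm_inv, norm_prod, ← Finset.prod_inv_distrib]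
        refine Finset.prod_le_prod (fun _ _ => by positivity) fun k _ => ?_
        have h1 : 1 - ‖a‖ * ‖q‖ ^ k ≤ ‖1 - a * q ^ k‖ := by
          simpa using norm_sub_norm_le (1 : ℂ) (a * q ^ k)
        have h2 : ‖a‖ * ‖q‖ ^ k ≤ ρ * ‖q‖ ^ k := by gcongr
        have h3 : ρ * ‖q‖ ^ k ≤ ρ :=
          mul_le_of_le_one_right hρ0 (pow_le_one₀ (norm_nonneg _) hq.le)
        have h4 : 0 ≤ ρ * ‖q‖ ^ k := by positivity
        have h5 : 1 - ρ * ‖q‖ ^ k ≤ ‖1 - a * q ^ k‖ := by linarith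
        have h6 : 0 < 1 - ρ * ‖q‖ ^ k := by linarith
        -- With `t = ρ |q|^k ≤ ρ`, one has `1 / (1 - t) = 1 + t / (1 - t) ≤ 1 + t / (1 - ρ)`.
        refine (inv_anti₀ h6 h5).trans ?_
        refine le_trans ?_ (Real.add_one_le_exp _)
        rw [div_mul_eq_mul_div, div_add_one hρ1.ne', inv_eq_one_div, div_le_div_iff₀ h6 hρ1]
        nlinarith
    _ = Real.exp (ρ / (1 - ρ) * ∑ k ∈ Finset.range n, ‖q‖ ^ k) := by
        rw [← Real.exp_sum, Finset.mul_sum]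
    _ ≤ _ := by
        gcongr
        exact sum_pow_range_le (norm_nonneg _) hq n

theorem differentiable_qPochInf {q : ℂ} (hq : ‖q‖ < 1) : Differentiable ℂ fun a => qPochInf a q := by
  intro x
  have hs : Summable fun k : ℕ => (‖x‖ + 1) * ‖q‖ ^ k :=
    (summable_geometric_of_lt_one (norm_nonneg _) hq).mul_left _
  have h := Summable.hasProdLocallyUniformlyOn_nat_one_add (f := fun (k : ℕ) (a : ℂ) => -(a * q ^ k))
    (Metric.isOpen_ball (x := (0 : ℂ)) (ε := ‖x‖ + 1)) hs
    (Eventually.of_forall fun n a ha => by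
      rw [mem_ball_zero_iff] at ha
      rw [norm_neg, norm_mul, norm_pow]
      gcongr)
    (fun n => by fun_prop)
  have hd := h.differentiableOn (.of_forall fun _ => by
    simpa [Finset.prod_fn] using DifferentiableOn.finsetProd (fun _ _ => by fun_prop))
    Metric.isOpen_ball
  have := hd.differentiableAt (Metric.isOpen_ball.mem_nhds (x := x) (by simp))
  simpa [qPochInf, sub_eq_add_neg] using this

theorem continuous_qPochInf {q : ℂ} (hq : ‖q‖ < 1) : Continuous fun a => qPochInf a q :=
  (differentiable_qPochInf hq).continuous

end QPochhammer

/-! ### The `q`-Gauss sum by a contiguous relation in its argument. -/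

section QGauss

/-- The `m`-th term of the `q`-Gauss series `₂φ₁(x, y; xys; q, s)`. -/
noncomputable def qGaussTerm (q x y s : ℂ) (m : ℕ) : ℂ :=
  qPoch x q m * qPoch y q m * s ^ m / (qPoch q q m * qPoch (x * y * s) q m)

theorem exists_norm_qGaussTerm_le {q : ℂ} (hq : ‖q‖ < 1) (x y : ℂ) {ρ : ℝ} (hρ : ρ < 1) :
    ∃ C : ℝ, ∀ s : ℂ, ‖x * y * s‖ ≤ ρ → ∀ m, ‖qGaussTerm q x y s m‖ ≤ C * ‖s‖ ^ m := by
  refine ⟨Real.exp (‖x‖ * (1 - ‖q‖)⁻¹) * Real.exp (‖y‖ * (1 - ‖q‖)⁻¹) *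
    (Real.exp (‖q‖ / (1 - ‖q‖) * (1 - ‖q‖)⁻¹) * Real.exp (ρ / (1 - ρ) * (1 - ‖q‖)⁻¹)),
    fun s hs m => ?_⟩
  have h1 := norm_qPoch_le x hq le_rfl m
  have h2 := norm_qPoch_le y hq le_rfl m
  have h3 := norm_inv_qPoch_le hq hq le_rfl m
  have h4 := norm_inv_qPoch_le hq hρ hs m
  calc ‖qGaussTerm q x y s m‖ = ‖qPoch x q m‖ * ‖qPoch y q m‖ *
        (‖(qPoch q q m)⁻¹‖ * ‖(qPoch (x * y * s) q m)⁻¹‖) * ‖s‖ ^ m := by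
        rw [qGaussTerm]
        simp only [norm_div, norm_mul, norm_pow, norm_inv]
        ring
    _ ≤ _ := by gcongr

theorem summable_qGaussTerm {q x y s : ℂ} (hq : ‖q‖ < 1) (hs : ‖s‖ < 1) (hxys : ‖x * y * s‖ < 1) :
    Summable (qGaussTerm q x y s) := by
  obtain ⟨C, hC⟩ := exists_norm_qGaussTerm_le hq x y hxys
  exact .of_norm_bounded ((summable_geometric_of_lt_one (norm_nonneg _) hs).mul_left C)
    (hC s le_rfl)

/-- A telescoping certificate for the step `s ↦ sq`. Taking `s`, rather than the lower parameter, as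
the free variable avoids dividing by `x` or `y`, so `x = 0` or `y = 0` is allowed. -/
theorem qGaussTerm_telescope {q x y s : ℂ} (hq : ‖q‖ < 1) (hxys : ‖x * y * s‖ < 1) (m : ℕ) :
    (1 - x * y * s) * (1 - s) * qGaussTerm q x y s m
      - (1 - x * s) * (1 - y * s) * qGaussTerm q x y (s * q) m =
    (1 - x * y * s) * (qGaussTerm q x y s m * (1 - q ^ m)
      - qGaussTerm q x y s (m + 1) * (1 - q ^ (m + 1))) := by
  have h1 := qPoch_ne_zero hq hq m
  have h2 := qPoch_ne_zero hxys hq m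
  have h3 := one_sub_ne_zero_of_norm_lt_one (norm_mul_pow_lt_one hxys hq m)
  have h4 : 1 - q * q ^ m ≠ 0 := one_sub_ne_zero_of_norm_lt_one (norm_mul_pow_lt_one hq hq m)
  have h5 := one_sub_ne_zero_of_norm_lt_one hxys
  have key : qPoch (x * y * (s * q)) q m =
      qPoch (x * y * s) q m * (1 - x * y * s * q ^ m) / (1 - x * y * s) := by
    rw [eq_div_iff h5, ← qPoch_succ, qPoch_succ', mul_comm, mul_assoc (x * y) s q]
  have key2 : qGaussTerm q x y (s * q) m = qGaussTerm q x y s m * q ^ m * (1 - x * y * s) /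
      (1 - x * y * s * q ^ m) := by
    rw [qGaussTerm, qGaussTerm, key, mul_pow]
    field_simp
  have key3 : qGaussTerm q x y s (m + 1) * (1 - q ^ (m + 1)) = qGaussTerm q x y s m *
      ((1 - x * q ^ m) * (1 - y * q ^ m) * s / (1 - x * y * s * q ^ m)) := by
    rw [qGaussTerm, qGaussTerm, qPoch_succ, qPoch_succ, qPoch_succ, qPoch_succ, pow_succ' q,
      pow_succ s]
    generalize 1 - q * q ^ m = u at *
    generalize 1 - x * y * s * q ^ m = v at *
    field_simp
  rw [key2, key3]
  generalize qGaussTerm q x y s m = t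
  generalize q ^ m = Q at *
  field_simp
  ring

theorem tsum_qGaussTerm_step {q x y s : ℂ} (hq : ‖q‖ < 1) (hs : ‖s‖ < 1)
    (hxys : ‖x * y * s‖ < 1) :
    (1 - x * y * s) * (1 - s) * ∑' m, qGaussTerm q x y s m =
      (1 - x * s) * (1 - y * s) * ∑' m, qGaussTerm q x y (s * q) m := by
  have hs' : ‖s * q‖ < 1 := by simpa using norm_mul_pow_lt_one hs hq 1
  have hxys' : ‖x * y * (s * q)‖ < 1 := by
    simpa [mul_assoc] using norm_mul_pow_lt_one hxys hq 1
  have S1 := summable_qGaussTerm hq hs hxys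
  have S2 := summable_qGaussTerm hq hs' hxys'
  rw [← sub_eq_zero, ← tsum_mul_left, ← tsum_mul_left, ← (S1.mul_left _).tsum_sub (S2.mul_left _)]
  simp_rw [qGaussTerm_telescope hq hxys]
  rw [tsum_mul_left]
  have hS : Summable fun m => qGaussTerm q x y s m * (1 - q ^ m)
      - qGaussTerm q x y s (m + 1) * (1 - q ^ (m + 1)) := by
    have := ((S1.mul_left ((1 - x * y * s) * (1 - s))).sub
      (S2.mul_left ((1 - x * s) * (1 - y * s)))).mul_left (1 - x * y * s)⁻¹
    refine this.congr fun m => ?_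
    rw [qGaussTerm_telescope hq hxys, inv_mul_cancel_left₀ (one_sub_ne_zero_of_norm_lt_one hxys)]
  have hT : Tendsto (fun m => qGaussTerm q x y s m * (1 - q ^ m)) atTop (𝓝 0) := by
    simpa using S1.tendsto_atTop_zero.mul
      ((tendsto_pow_atTop_nhds_zero_of_norm_lt_one hq).const_sub 1)
  have h0 := hS.hasSum.tendsto_sum_nat
  simp_rw [Finset.sum_range_sub' (fun m => qGaussTerm q x y s m * (1 - q ^ m))] at h0
  have h1 := tendsto_nhds_unique h0 (hT.const_sub _)
  -- Both ends of the telescoping sum vanish: the terms tend to zero, and the initial one carries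
  -- the factor `1 - q ^ 0`.
  rw [h1]
  simp

theorem tsum_qGaussTerm_iterate {q x y s : ℂ} (hq : ‖q‖ < 1) (hs : ‖s‖ < 1)
    (hxys : ‖x * y * s‖ < 1) (n : ℕ) :
    qPoch (x * y * s) q n * qPoch s q n * ∑' m, qGaussTerm q x y s m =
      qPoch (x * s) q n * qPoch (y * s) q n * ∑' m, qGaussTerm q x y (s * q ^ n) m := by
  induction n with
  | zero => simp [qPoch_zero]
  | succ n ih =>
    have h1 := norm_mul_pow_lt_one hs hq n
    have h2 : ‖x * y * (s * q ^ n)‖ < 1 := by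
      simpa [mul_assoc] using norm_mul_pow_lt_one hxys hq n
    have := tsum_qGaussTerm_step hq h1 h2
    rw [show s * q ^ n * q = s * q ^ (n + 1) by ring] at this
    simp only [qPoch_succ]
    linear_combination (1 - x * y * s * q ^ n) * (1 - s * q ^ n) * ih
      + qPoch (x * s) q n * qPoch (y * s) q n * this

theorem tendsto_tsum_qGaussTerm {q x y s : ℂ} (hq : ‖q‖ < 1) (hs : ‖s‖ < 1)
    (hxys : ‖x * y * s‖ < 1) :
    Tendsto (fun n : ℕ => ∑' m, qGaussTerm q x y (s * q ^ n) m) atTop (𝓝 1) := by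
  obtain ⟨C, hC⟩ := exists_norm_qGaussTerm_le hq x y hxys
  have hle : ∀ n : ℕ, ‖s * q ^ n‖ ≤ ‖s‖ := fun n => by
    rw [norm_mul, norm_pow]
    exact mul_le_of_le_one_right (norm_nonneg _) (pow_le_one₀ (norm_nonneg _) hq.le)
  have hC0 : 0 ≤ C := by simpa using (norm_nonneg _).trans (hC s le_rfl 0)
  have h0 : ∑' m, qGaussTerm q x y 0 m = 1 := by
    rw [tsum_eq_single 0 (fun m hm => by simp [qGaussTerm, hm])]
    simp [qGaussTerm, qPoch_zero]
  rw [← h0]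
  refine tendsto_tsum_of_dominated_convergence (bound := fun m => C * ‖s‖ ^ m)
    ((summable_geometric_of_lt_one (norm_nonneg _) hs).mul_left C) (fun m => ?_)
    (.of_forall fun n m => ?_)
  · have hc : ContinuousAt (fun t => qGaussTerm q x y t m) 0 := by
      unfold qGaussTerm
      refine ContinuousAt.div (by fun_prop) ?_ ?_
      · exact continuousAt_const.mul
          (((continuous_qPoch_left q m).comp (continuous_const.mul continuous_id)).continuousAt)
      · simpa [qPoch_zero_left] using qPoch_ne_zero hq hq m
    have hl : Tendsto (fun n : ℕ => s * q ^ n) atTop (𝓝 0) := by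
      simpa using (tendsto_pow_atTop_nhds_zero_of_norm_lt_one hq).const_mul s
    exact hc.tendsto.comp hl
  · refine (hC _ ?_ m).trans ?_
    · rw [norm_mul]
      rw [norm_mul _ s]
      gcongr
      exact hle n
    · gcongr
      exact hle n

/-- The `q`-Gauss sum. -/
theorem hasSum_qGaussTerm {q x y s : ℂ} (hq : ‖q‖ < 1) (hs : ‖s‖ < 1) (hxys : ‖x * y * s‖ < 1) :
    HasSum (qGaussTerm q x y s)
      (qPochInf (x * s) q * qPochInf (y * s) q / (qPochInf (x * y * s) q * qPochInf s q)) := by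
  have h := (summable_qGaussTerm hq hs hxys).hasSum
  have h1 : Tendsto (fun n => qPoch (x * y * s) q n * qPoch s q n * ∑' m, qGaussTerm q x y s m)
      atTop (𝓝 (qPochInf (x * y * s) q * qPochInf s q * ∑' m, qGaussTerm q x y s m)) :=
    ((tendsto_qPoch _ hq).mul (tendsto_qPoch _ hq)).mul_const _
  simp_rw [tsum_qGaussTerm_iterate hq hs hxys] at h1
  have h2 := ((tendsto_qPoch (x * s) hq).mul (tendsto_qPoch (y * s) hq)).mul
    (tendsto_tsum_qGaussTerm hq hs hxys)
  have h3 := tendsto_nhds_unique h1 h2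
  have := qPochInf_ne_zero hxys hq
  have := qPochInf_ne_zero hs hq
  have h4 : ∑' m, qGaussTerm q x y s m = qPochInf (x * s) q * qPochInf (y * s) q /
      (qPochInf (x * y * s) q * qPochInf s q) := by
    rw [eq_div_iff (by positivity), mul_comm, h3, mul_one]
  rwa [h4] at h

end QGauss

/-! ### The even-supported Bailey pair. -/

section WellPoised

/-- The even-indexed entries of the Bailey pair relative to `α`, whose odd-indexed entries vanish
and whose `β`-side is `1 / ((q; q)_n (qα; q²)_n)`. -/
noncomputable def baileyCoeff (q α : ℂ) (m : ℕ) : ℂ :=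
  (1 - α * q ^ (4 * m)) * qPoch α (q ^ 2) m / ((1 - α) * qPoch (q ^ 2) (q ^ 2) m) *
    (-α) ^ m * q ^ (3 * m ^ 2 - m)

/-- In base `q⁻¹`, `qPoch (q ^ n) q⁻¹ j` equals `(q; q)_n / (q; q)_{n-j}` when `j ≤ n` and vanishes
otherwise. It encodes the finite support of the Bailey sum without truncated subtraction. -/
theorem qPoch_pow_inv_eq_zero {q : ℂ} (hq0 : q ≠ 0) {n j : ℕ} (h : n < j) :
    qPoch (q ^ n) q⁻¹ j = 0 :=
  Finset.prod_eq_zero (Finset.mem_range.2 h) (by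
    rw [← mul_pow, mul_inv_cancel₀ hq0, one_pow, sub_self])

theorem qPoch_self_add {q : ℂ} (hq0 : q ≠ 0) (k j : ℕ) :
    qPoch q q (k + j) = qPoch q q k * qPoch (q ^ (k + j)) q⁻¹ j := by
  induction j with
  | zero => simp [qPoch_zero]
  | succ j ih =>
    rw [qPoch_succ', ← add_assoc, qPoch_succ, ih, pow_succ (n := k + j),
      mul_inv_cancel_right₀ hq0]
    ring

theorem baileyCoeff_zero {q α : ℂ} (hα : α ≠ 1) : baileyCoeff q α 0 = 1 := by
  have : 1 - α ≠ 0 := sub_ne_zero.2 hα.symm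
  simp [baileyCoeff, qPoch_zero, this]

theorem baileyCoeff_succ {q α : ℂ} (hα : α ≠ 1) (m : ℕ) :
    baileyCoeff q α (m + 1) = (1 - α * q ^ 4 * (q ^ m) ^ 4) * qPoch (α * q ^ 2) (q ^ 2) m /
      (qPoch (q ^ 2) (q ^ 2) m * (1 - q ^ 2 * (q ^ m) ^ 2)) * (-α) ^ (m + 1) *
      (q ^ (3 * m ^ 2 + 3 * m) * (q ^ m) ^ 2 * q ^ 2) := by
  have : 1 - α ≠ 0 := sub_ne_zero.2 hα.symm
  have e : 3 * (m + 1) ^ 2 - (m + 1) = 3 * m ^ 2 + 3 * m + m * 2 + 2 := by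
    rw [Nat.sub_eq_iff_eq_add (by nlinarith)]; ring
  rw [baileyCoeff, qPoch_succ', qPoch_succ (q ^ 2), e, pow_add q (3 * m ^ 2 + 3 * m + m * 2),
    pow_add q (3 * m ^ 2 + 3 * m) (m * 2), pow_mul q m 2, mul_add 4 m 1, pow_add q (4 * m),
    mul_comm 4 m, pow_mul q m 4, ← pow_mul q 2 m, mul_comm 2 m, pow_mul q m 2]
  field_simp

/-- Here `N` plays the role of `q ^ n`. The combination of the sums at `n + 1` and `n` is the one
that vanishes if the closed form of `sum_baileyCoeff` is right, and its partial sums in `m` have a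
product form. That product contains `qPoch N q⁻¹ (2 * K + 1)`, which is zero at `N = q ^ n` once `n
≤ 2 * K`. -/
theorem sum_baileyCoeff_telescope {q α N : ℂ} (hq0 : q ≠ 0) (hq : ‖q‖ < 1) (hα : α ≠ 1)
    (hN : ‖α * q * N‖ < 1) (K : ℕ) :
    ∑ m ∈ Finset.range (K + 1), ((1 - α * q * N ^ 2) * (baileyCoeff q α m *
        qPoch (N * q) q⁻¹ (2 * m) / qPoch (α * q * (N * q)) q (2 * m)) -
      (1 - α * q * N) * (baileyCoeff q α m *
        qPoch N q⁻¹ (2 * m) / qPoch (α * q * N) q (2 * m))) =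
    α * q * N * (qPoch (α * q ^ 2) (q ^ 2) K / qPoch (q ^ 2) (q ^ 2) K * (-α) ^ K *
      q ^ (3 * K ^ 2 + 3 * K) * qPoch N q⁻¹ (2 * K + 1) / qPoch (α * q * (N * q)) q (2 * K)) := by
  induction K with
  | zero =>
    simp [baileyCoeff_zero hα, qPoch_zero, qPoch_succ]
    ring
  | succ K ih =>
    rw [Finset.sum_range_succ, ih, baileyCoeff_succ hα]
    have hq2 : ‖q ^ 2‖ < 1 := by
      rw [norm_pow]; exact pow_lt_one₀ (norm_nonneg _) hq two_ne_zero
    have hN' : ‖α * q * (N * q)‖ < 1 := by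
      simpa [mul_assoc] using norm_mul_pow_lt_one hN hq 1
    have n1 := qPoch_ne_zero hq2 hq2 K
    have n2 := qPoch_ne_zero hN' hq (2 * K)
    have n3 := one_sub_ne_zero_of_norm_lt_one hN
    have n4 := one_sub_ne_zero_of_norm_lt_one (norm_mul_pow_lt_one hN' hq (2 * K))
    have n5 := one_sub_ne_zero_of_norm_lt_one (norm_mul_pow_lt_one hN' hq (2 * K + 1))
    have n6 := one_sub_ne_zero_of_norm_lt_one (norm_mul_pow_lt_one hq2 hq2 K)
    have n7 : q ^ K ≠ 0 := pow_ne_zero _ hq0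
    have e1 : qPoch (N * q) q⁻¹ (2 * (K + 1)) = (1 - N * q) * qPoch N q⁻¹ (2 * K + 1) := by
      rw [show 2 * (K + 1) = 2 * K + 1 + 1 by ring, qPoch_succ', mul_inv_cancel_right₀ hq0]
    have e2 : qPoch N q⁻¹ (2 * (K + 1)) =
        qPoch N q⁻¹ (2 * K + 1) * (1 - N * (q⁻¹) ^ (2 * K + 1)) := by
      rw [show 2 * (K + 1) = 2 * K + 1 + 1 by ring, qPoch_succ]
    have e3 : qPoch (α * q * N) q (2 * (K + 1)) =
        (1 - α * q * N) * (qPoch (α * q * (N * q)) q (2 * K) *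
          (1 - α * q * (N * q) * q ^ (2 * K))) := by
      rw [show 2 * (K + 1) = 2 * K + 1 + 1 by ring, qPoch_succ', qPoch_succ,
        mul_assoc (α * q) N q]
    have e4 : qPoch (α * q * (N * q)) q (2 * (K + 1)) =
        qPoch (α * q * (N * q)) q (2 * K) * (1 - α * q * (N * q) * q ^ (2 * K)) *
          (1 - α * q * (N * q) * q ^ (2 * K + 1)) := by
      rw [show 2 * (K + 1) = 2 * K + 1 + 1 by ring, qPoch_succ, qPoch_succ]
    have e5 : qPoch N q⁻¹ (2 * (K + 1) + 1) =
        qPoch N q⁻¹ (2 * K + 1) * (1 - N * (q⁻¹) ^ (2 * K + 1)) *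
          (1 - N * (q⁻¹) ^ (2 * K + 2)) := by
      rw [show 2 * (K + 1) + 1 = 2 * K + 1 + 1 + 1 by ring, qPoch_succ, qPoch_succ]
    have e6 : q ^ (3 * (K + 1) ^ 2 + 3 * (K + 1)) =
        q ^ (3 * K ^ 2 + 3 * K) * (q ^ K) ^ 6 * q ^ 6 := by ring
    have p1 : q ^ (2 * K) = (q ^ K) ^ 2 := by ring
    have p2 : q ^ (2 * K + 1) = (q ^ K) ^ 2 * q := by ring
    have p3 : (q⁻¹) ^ (2 * K + 1) = ((q ^ K) ^ 2 * q)⁻¹ := by rw [inv_pow, p2]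
    have p4 : (q⁻¹) ^ (2 * K + 2) = ((q ^ K) ^ 2 * q ^ 2)⁻¹ := by rw [inv_pow]; ring
    have p5 : (q ^ 2) ^ K = (q ^ K) ^ 2 := by ring
    rw [e1, e2, e3, e4, e5, e6, qPoch_succ (α * q ^ 2), qPoch_succ (q ^ 2), p3, p4, p2, p5, p1,
      pow_succ (-α)]
    rw [p1] at n4
    rw [p2] at n5
    rw [p5] at n6
    generalize qPoch (α * q ^ 2) (q ^ 2) K = X1
    generalize qPoch (q ^ 2) (q ^ 2) K = X2 at *
    generalize qPoch (α * q * (N * q)) q (2 * K) = X3 at *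
    generalize qPoch N q⁻¹ (2 * K + 1) = X4 at *
    generalize q ^ (3 * K ^ 2 + 3 * K) = X5
    generalize (-α) ^ K = X6
    generalize q ^ K = M at *
    -- The induction step with the common factor `X1 / X2 * X6 * X5 * X4 / X3` removed: a rational
    -- identity in `α`, `q`, `N` and `M = q ^ K`.
    have step : α * q * N + (-α) * (M ^ 2 * q ^ 2) * (1 - α * q ^ 4 * M ^ 4) /
        (1 - q ^ 2 * M ^ 2) * ((1 - α * q * N ^ 2) * (1 - N * q) /
          ((1 - α * q * (N * q) * M ^ 2) * (1 - α * q * (N * q) * (M ^ 2 * q))) -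
          (1 - N * (M ^ 2 * q)⁻¹) / (1 - α * q * (N * q) * M ^ 2)) =
        α * q * N * ((1 - α * q ^ 2 * M ^ 2) / (1 - q ^ 2 * M ^ 2) * (-α) * (M ^ 6 * q ^ 6) *
          ((1 - N * (M ^ 2 * q)⁻¹) * (1 - N * (M ^ 2 * q ^ 2)⁻¹)) /
          ((1 - α * q * (N * q) * M ^ 2) * (1 - α * q * (N * q) * (M ^ 2 * q)))) := by
      obtain ⟨u, hu⟩ : ∃ u, u = 1 - α * q * (N * q) * M ^ 2 := ⟨_, rfl⟩
      obtain ⟨v, hv⟩ : ∃ v, v = 1 - α * q * (N * q) * (M ^ 2 * q) := ⟨_, rfl⟩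
      obtain ⟨w, hw⟩ : ∃ w, w = 1 - q ^ 2 * M ^ 2 := ⟨_, rfl⟩
      rw [← hu, ← hv, ← hw]
      rw [← hu] at n4
      rw [← hv] at n5
      rw [← hw] at n6
      field_simp
      rw [hu, hv, hw]
      ring
    have hx := congrArg (fun t => X1 / X2 * X6 * X5 * X4 / X3 * t) step
    generalize 1 - α * q * (N * q) * M ^ 2 = u at *
    generalize 1 - α * q * (N * q) * (M ^ 2 * q) = v at *
    generalize 1 - q ^ 2 * M ^ 2 = w at *
    generalize (M ^ 2 * q)⁻¹ = i at *
    generalize (M ^ 2 * q ^ 2)⁻¹ = j at *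
    convert hx using 1
    · field_simp
      ring
    · field_simp

/-- Induction on `n` through the first-order recurrence from `sum_baileyCoeff_telescope`. The range
is governed by a separate `K`, so that the sums for `n` and `n + 1` run over the same indices. -/
theorem sum_baileyCoeff {q α : ℂ} (hq0 : q ≠ 0) (hq : ‖q‖ < 1) (hα : α ≠ 1)
    (hqα : ‖q * α‖ < 1) (n K : ℕ) (hn : n ≤ 2 * K) :
    ∑ m ∈ Finset.range (K + 1), baileyCoeff q α m *
        qPoch (q ^ n) q⁻¹ (2 * m) / qPoch (α * q * q ^ n) q (2 * m) =
      qPoch (α * q) q n / qPoch (q * α) (q ^ 2) n := by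
  induction n with
  | zero =>
    rw [Finset.sum_range_succ', Finset.sum_eq_zero]
    · simp [baileyCoeff_zero hα, qPoch_zero]
    · intro m _
      rw [qPoch_pow_inv_eq_zero hq0 (by lia)]
      simp
  | succ n ih =>
    have hN : ‖α * q * q ^ n‖ < 1 := by
      rw [mul_comm α]; exact norm_mul_pow_lt_one hqα hq n
    have hq2 : ‖q ^ 2‖ < 1 := by
      rw [norm_pow]; exact pow_lt_one₀ (norm_nonneg _) hq two_ne_zero
    have h := sum_baileyCoeff_telescope hq0 hq hα hN K
    rw [qPoch_pow_inv_eq_zero hq0 (by lia), Finset.sum_sub_distrib, ← Finset.mul_sum,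
      ← Finset.mul_sum, ih (by lia), ← pow_succ] at h
    have n1 := one_sub_ne_zero_of_norm_lt_one (norm_mul_pow_lt_one hqα hq2 n)
    have n2 := qPoch_ne_zero hqα hq2 n
    have e : q * α * (q ^ 2) ^ n = α * q * (q ^ n) ^ 2 := by ring
    rw [qPoch_succ, qPoch_succ, e, eq_div_iff (by rw [e] at n1; positivity)]
    rw [e] at n1
    simp only [mul_zero, zero_div] at h
    rw [sub_eq_zero] at h
    rw [mul_comm (qPoch (q * α) (q ^ 2) n), ← mul_assoc, mul_comm _ (1 - α * q * (q ^ n) ^ 2), h]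
    generalize qPoch (q * α) (q ^ 2) n = D at *
    field_simp

end WellPoised

/-! ### Bounds and base-squaring identities for infinite products. -/

section InfiniteProducts

theorem norm_qPochInf_le {a q : ℂ} (hq : ‖q‖ < 1) {ρ : ℝ} (ha : ‖a‖ ≤ ρ) :
    ‖qPochInf a q‖ ≤ Real.exp (ρ * (1 - ‖q‖)⁻¹) :=
  le_of_tendsto (tendsto_qPoch a hq).norm (.of_forall fun n => norm_qPoch_le a hq ha n)

theorem norm_inv_qPochInf_le {a q : ℂ} (hq : ‖q‖ < 1) {ρ : ℝ} (hρ : ρ < 1) (ha : ‖a‖ ≤ ρ) :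
    ‖(qPochInf a q)⁻¹‖ ≤ Real.exp (ρ / (1 - ρ) * (1 - ‖q‖)⁻¹) :=
  le_of_tendsto ((tendsto_qPoch a hq).inv₀ (qPochInf_ne_zero (ha.trans_lt hρ) hq)).norm
    (.of_forall fun n => norm_inv_qPoch_le hq hρ ha n)

theorem norm_sq_lt_one {q : ℂ} (hq : ‖q‖ < 1) : ‖q ^ 2‖ < 1 := by
  rw [norm_pow]; exact pow_lt_one₀ (norm_nonneg _) hq two_ne_zero

theorem qPochInf_mul_neg (x : ℂ) {q : ℂ} (hq : ‖q‖ < 1) :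
    qPochInf x q * qPochInf (-x) q = qPochInf (x ^ 2) (q ^ 2) := by
  unfold qPochInf
  rw [← (qPochInf_multipliable _ q hq).tprod_mul (qPochInf_multipliable _ q hq)]
  refine tprod_congr fun k => ?_
  ring

theorem qPochInf_sq_mul (y : ℂ) {q : ℂ} (hq : ‖q‖ < 1) :
    qPochInf y (q ^ 2) * qPochInf (y * q) (q ^ 2) = qPochInf y q := by
  have h0 := qPochInf_multipliable y (q ^ 2) (norm_sq_lt_one hq)
  have h1 := qPochInf_multipliable (y * q) (q ^ 2) (norm_sq_lt_one hq)
  have e0 : ∀ k : ℕ, 1 - y * (q ^ 2) ^ k = 1 - y * q ^ (2 * k) := fun k => by ring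
  have e1 : ∀ k : ℕ, 1 - y * q * (q ^ 2) ^ k = 1 - y * q ^ (2 * k + 1) := fun k => by ring
  unfold qPochInf
  simp_rw [e0] at h0 ⊢
  simp_rw [e1] at h1 ⊢
  exact tprod_even_mul_odd (f := fun k => 1 - y * q ^ k) h0 h1

/-- Euler's identity: `(q; q)_∞ (-q; q)_∞ = (q²; q²)_∞`, while `(q; q)_∞ = (q; q²)_∞ (q²; q²)_∞`. -/
theorem qPochInf_sq_mul_neg {q : ℂ} (hq : ‖q‖ < 1) :
    qPochInf q (q ^ 2) * qPochInf (-q) q = 1 := by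
  have h1 := qPochInf_mul_neg q hq
  have h2 := qPochInf_sq_mul q hq
  rw [← pow_two] at h2
  have h3 := qPochInf_ne_zero (norm_sq_lt_one hq) (norm_sq_lt_one hq)
  refine mul_right_cancel₀ h3 ?_
  rw [one_mul, mul_right_comm, h2, h1]

end InfiniteProducts

/-! ### The Nassrallah–Rahman integral over the full circle. -/

section NassrallahRahman

/-- The product `(tz, t/z; q)_∞`. -/
noncomputable def qPair (q t z : ℂ) : ℂ := qPochInf (t * z) q * qPochInf (t * z⁻¹) q

/-- The integrand of the Nassrallah–Rahman integral as a function of `z = e^{iθ}`. -/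
noncomputable def nrWeight (q a b c d r z : ℂ) : ℂ :=
  qPochInf (z ^ 2) q * qPochInf (z⁻¹ ^ 2) q * qPair q (a * b * c * d * r) z /
    (qPair q a z * qPair q b z * qPair q c z * qPair q d z * qPair q r z)

/-- The function whose `q`-difference expresses the contiguous relation of `nrWeight`. -/
noncomputable def nrPrimitive (q a b c d r z : ℂ) : ℂ :=
  qPochInf (z ^ 2 * q) q * qPochInf (z⁻¹ ^ 2) q *
    (qPochInf (a * b * c * d * r * z * q) q * qPochInf (a * b * c * d * r * z⁻¹) q) * z⁻¹ /
  ((qPochInf (a * z * q) q * qPochInf (a * z⁻¹) q) *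
    (qPochInf (b * z * q) q * qPochInf (b * z⁻¹) q) *
    (qPochInf (c * z * q) q * qPochInf (c * z⁻¹) q) *
    (qPochInf (d * z * q) q * qPochInf (d * z⁻¹) q) *
    (qPochInf (r * z * q) q * qPochInf (r * z⁻¹) q))

theorem norm_mul_inv_lt_one {t z : ℂ} (ht : ‖t‖ < 1) (hz : 1 ≤ ‖z‖) : ‖t * z⁻¹‖ < 1 := by
  rw [norm_mul, norm_inv]
  exact (mul_le_of_le_one_right (norm_nonneg _) (inv_le_one_of_one_le₀ hz)).trans_lt ht

theorem qPair_ne_zero {q t z : ℂ} (hq : ‖q‖ < 1) (ht : ‖t‖ < 1) (hz : ‖z‖ = 1) :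
    qPair q t z ≠ 0 :=
  mul_ne_zero (qPochInf_ne_zero (by simpa [hz] using ht) hq)
    (qPochInf_ne_zero (norm_mul_inv_lt_one ht hz.ge) hq)

theorem qPair_zero (q z : ℂ) : qPair q 0 z = 1 := by simp [qPair, qPochInf_zero_left]

/-- The algebraic core of `nrWeight_contiguous`: what remains of the contiguous relation after all
infinite products common to its terms are removed. -/
theorem nrWeight_poly (a b c d r z : ℂ) (hz : z ≠ 0) :
    (1 - z ^ 2) * (1 - z⁻¹ ^ 2) * ((1 - a * z) * (1 - a * z⁻¹) *
      ((1 - a * c * d * r) * (1 - a * b * d * r) * (1 - a * b * c * r) * (1 - a * b * c * d)) -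
      (1 - a * b * c * d * r * z) * (1 - a * b * c * d * r * z⁻¹) *
        ((1 - a * b) * (1 - a * c) * (1 - a * d) * (1 - a * r))) =
    -a * (1 - a * b * c * d * r * a) *
      ((1 - z⁻¹ ^ 2) * (1 - a * b * c * d * r * z⁻¹) * z⁻¹ *
        ((1 - a * z) * (1 - b * z) * (1 - c * z) * (1 - d * z) * (1 - r * z)) +
      z * (1 - z ^ 2) * (1 - a * b * c * d * r * z) *
        ((1 - a * z⁻¹) * (1 - b * z⁻¹) * (1 - c * z⁻¹) * (1 - d * z⁻¹) * (1 - r * z⁻¹))) := by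
  field_simp
  ring

/-- The right-hand side is `-nrPrimitive q a b c d r z⁻¹`: replacing `z` by `z / q` interchanges the
two halves of every pair, and the sign comes from `(1 - z²/q) q/z = -z (1 - q/z²)`. -/
theorem nrPrimitive_shift {q a b c d r z : ℂ} (hq0 : q ≠ 0) (hq : ‖q‖ < 1) (hz : ‖z‖ = 1) :
    nrPrimitive q a b c d r (z * q⁻¹) =
      -(z * qPochInf (z ^ 2) q * qPochInf (z⁻¹ ^ 2 * q) q *
        (qPochInf (a * b * c * d * r * z) q * qPochInf (a * b * c * d * r * z⁻¹ * q) q)) /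
      ((qPochInf (a * z) q * qPochInf (a * z⁻¹ * q) q) *
        (qPochInf (b * z) q * qPochInf (b * z⁻¹ * q) q) *
        (qPochInf (c * z) q * qPochInf (c * z⁻¹ * q) q) *
        (qPochInf (d * z) q * qPochInf (d * z⁻¹ * q) q) *
        (qPochInf (r * z) q * qPochInf (r * z⁻¹ * q) q)) := by
  have hz0 : z ≠ 0 := by rintro rfl; simp at hz
  have e1 : ∀ t : ℂ, t * (z * q⁻¹) * q = t * z := fun t => by field_simp
  have e2 : ∀ t : ℂ, t * (z * q⁻¹)⁻¹ = t * z⁻¹ * q := fun t => by field_simp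
  have e3 : (z * q⁻¹) ^ 2 * q = z ^ 2 * q⁻¹ := by field_simp
  have e4 : (z * q⁻¹)⁻¹ ^ 2 = z⁻¹ ^ 2 * q * q := by field_simp
  have h1 := qPochInf_step (z ^ 2 * q⁻¹) hq
  have h2 := qPochInf_step (z⁻¹ ^ 2 * q) hq
  rw [inv_mul_cancel_right₀ hq0] at h1
  unfold nrPrimitive
  rw [e3, e4, h1, h2]
  simp only [e1, e2]
  have e5 : (1 - z ^ 2 * q⁻¹) * (z⁻¹ * q) = -(z * (1 - z⁻¹ ^ 2 * q)) := by
    field_simp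
    ring
  congr 1
  linear_combination (qPochInf (z ^ 2) q * qPochInf (z⁻¹ ^ 2 * q * q) q *
    (qPochInf (a * b * c * d * r * z) q * qPochInf (a * b * c * d * r * z⁻¹ * q) q)) * e5

/-- Splitting the first factor off each infinite product leaves the same tails in every term, and
`nrWeight_poly` remains. The condition `‖z‖ = 1` keeps the denominators nonzero. -/
theorem nrWeight_contiguous {q a b c d r z : ℂ} (hq0 : q ≠ 0) (hq : ‖q‖ < 1)
    (ha : ‖a‖ < 1) (hb : ‖b‖ < 1) (hc : ‖c‖ < 1) (hd : ‖d‖ < 1) (hr : ‖r‖ < 1) (hz : ‖z‖ = 1) :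
    nrWeight q (a * q) b c d r z *
      ((1 - a * c * d * r) * (1 - a * b * d * r) * (1 - a * b * c * r) * (1 - a * b * c * d)) -
    nrWeight q a b c d r z * ((1 - a * b) * (1 - a * c) * (1 - a * d) * (1 - a * r)) =
    -a * (1 - a * b * c * d * r * a) *
      (nrPrimitive q a b c d r z - nrPrimitive q a b c d r (z * q⁻¹)) := by
  have hz0 : z ≠ 0 := by rintro rfl; simp at hz
  rw [nrPrimitive_shift hq0 hq hz]
  have f1 : ∀ t : ℂ, ‖t‖ < 1 → 1 - t * z ≠ 0 := fun t ht =>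
    one_sub_ne_zero_of_norm_lt_one (by simpa [hz] using ht)
  have f2 : ∀ t : ℂ, ‖t‖ < 1 → 1 - t * z⁻¹ ≠ 0 := fun t ht =>
    one_sub_ne_zero_of_norm_lt_one (norm_mul_inv_lt_one ht hz.ge)
  have g1 : ∀ t : ℂ, ‖t‖ < 1 → qPochInf (t * z * q) q ≠ 0 := fun t ht =>
    qPochInf_ne_zero (by
      simpa using norm_mul_pow_lt_one (a := t * z) (by simpa [hz] using ht) hq 1) hq
  have g2 : ∀ t : ℂ, ‖t‖ < 1 → qPochInf (t * z⁻¹ * q) q ≠ 0 := fun t ht =>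
    qPochInf_ne_zero (by
      simpa using norm_mul_pow_lt_one (norm_mul_inv_lt_one ht hz.ge) hq 1) hq
  have poly := nrWeight_poly a b c d r z hz0
  unfold nrWeight nrPrimitive qPair
  rw [show a * q * b * c * d * r * z = a * b * c * d * r * z * q by ring,
    show a * q * b * c * d * r * z⁻¹ = a * b * c * d * r * z⁻¹ * q by ring,
    show a * q * z = a * z * q by ring, show a * q * z⁻¹ = a * z⁻¹ * q by ring,
    qPochInf_step (z ^ 2) hq, qPochInf_step (z⁻¹ ^ 2) hq,
    qPochInf_step (a * b * c * d * r * z) hq, qPochInf_step (a * b * c * d * r * z⁻¹) hq,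
    qPochInf_step (a * z) hq, qPochInf_step (a * z⁻¹) hq,
    qPochInf_step (b * z) hq, qPochInf_step (b * z⁻¹) hq,
    qPochInf_step (c * z) hq, qPochInf_step (c * z⁻¹) hq,
    qPochInf_step (d * z) hq, qPochInf_step (d * z⁻¹) hq,
    qPochInf_step (r * z) hq, qPochInf_step (r * z⁻¹) hq]
  have a1 := f1 a ha; have a2 := f2 a ha; have a3 := g1 a ha; have a4 := g2 a ha
  have b1 := f1 b hb; have b2 := f2 b hb; have b3 := g1 b hb; have b4 := g2 b hb
  have c1 := f1 c hc; have c2 := f2 c hc; have c3 := g1 c hc; have c4 := g2 c hc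
  have d1 := f1 d hd; have d2 := f2 d hd; have d3 := g1 d hd; have d4 := g2 d hd
  have r1 := f1 r hr; have r2 := f2 r hr; have r3 := g1 r hr; have r4 := g2 r hr
  generalize qPochInf (z ^ 2 * q) q = Z1
  generalize qPochInf (z⁻¹ ^ 2 * q) q = Z2
  generalize qPochInf (a * b * c * d * r * z * q) q = Z3
  generalize qPochInf (a * b * c * d * r * z⁻¹ * q) q = Z4
  generalize qPochInf (a * z * q) q = A3 at *
  generalize qPochInf (a * z⁻¹ * q) q = A4 at *
  generalize qPochInf (b * z * q) q = B3 at *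
  generalize qPochInf (b * z⁻¹ * q) q = B4 at *
  generalize qPochInf (c * z * q) q = C3 at *
  generalize qPochInf (c * z⁻¹ * q) q = C4 at *
  generalize qPochInf (d * z * q) q = D3 at *
  generalize qPochInf (d * z⁻¹ * q) q = D4 at *
  generalize qPochInf (r * z * q) q = R3 at *
  generalize qPochInf (r * z⁻¹ * q) q = R4 at *
  generalize (1 - a * c * d * r) * (1 - a * b * d * r) * (1 - a * b * c * r) *
    (1 - a * b * c * d) = u at *
  generalize (1 - a * b) * (1 - a * c) * (1 - a * d) * (1 - a * r) = v at *
  generalize 1 - a * b * c * d * r * a = u' at *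
  generalize 1 - a * b * c * d * r * z = s1 at *
  generalize 1 - a * b * c * d * r * z⁻¹ = s2 at *
  generalize 1 - a * z = A1 at *
  generalize 1 - a * z⁻¹ = A2 at *
  generalize 1 - b * z = B1 at *
  generalize 1 - b * z⁻¹ = B2 at *
  generalize 1 - c * z = C1 at *
  generalize 1 - c * z⁻¹ = C2 at *
  generalize 1 - d * z = D1 at *
  generalize 1 - d * z⁻¹ = D2 at *
  generalize 1 - r * z = R1 at *
  generalize 1 - r * z⁻¹ = R2 at *
  generalize 1 - z ^ 2 = z1 at *
  generalize 1 - z⁻¹ ^ 2 = z2 at *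
  generalize z⁻¹ = w at *
  have hx := congrArg (fun t => Z1 * Z2 * Z3 * Z4 / (A1 * A2 * A3 * A4 * B1 * B2 * B3 * B4 *
    C1 * C2 * C3 * C4 * D1 * D2 * D3 * D4 * R1 * R2 * R3 * R4) * t) poly
  beta_reduce at hx
  convert hx using 1
  · field_simp
  · field_simp
    ring

/-- Cauchy's theorem on an annulus, with `dθ = dz / (iz)`. -/
theorem integral_circle_eq {f : ℂ → ℂ} {R : ℝ} (hR : 1 ≤ R)
    (hf : ∀ z : ℂ, 1 ≤ ‖z‖ → ‖z‖ ≤ R → DifferentiableAt ℂ f z) :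
    ∫ θ in (0 : ℝ)..2 * π, f (Complex.exp (Complex.I * θ) * R) =
      ∫ θ in (0 : ℝ)..2 * π, f (Complex.exp (Complex.I * θ)) := by
  have h := Complex.circleIntegral_sub_center_inv_smul_eq_of_differentiable_on_annulus_off_countable
    (c := 0) one_pos hR (f := f) Set.countable_empty
    (fun z hz => (hf z (by simpa using hz.2) (by simpa using hz.1)).continuousAt.continuousWithinAt)
    (fun z hz => hf z (not_le.1 fun h => hz.1.2 (mem_closedBall_zero_iff.2 h)).le
      (mem_ball_zero_iff.1 hz.1.1).le)
  have key : ∀ ρ : ℝ, 0 < ρ → (∮ z in C(0, ρ), (z - 0)⁻¹ • f z) =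
      Complex.I * ∫ θ in (0 : ℝ)..2 * π, f (Complex.exp (Complex.I * θ) * ρ) := by
    intro ρ hρ
    rw [circleIntegral, ← intervalIntegral.integral_const_mul]
    refine intervalIntegral.integral_congr fun θ _ => ?_
    have h1 : circleMap 0 ρ θ = Complex.exp (Complex.I * θ) * ρ := by
      rw [circleMap_zero, mul_comm, mul_comm (θ : ℂ)]
    have h2 : circleMap 0 ρ θ ≠ 0 := circleMap_ne_center hρ.ne'
    simp only [deriv_circleMap, sub_zero, smul_eq_mul]
    rw [← h1]
    field_simp
  rw [key R (one_pos.trans_le hR), key 1 one_pos] at h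
  simpa using mul_left_cancel₀ Complex.I_ne_zero h

theorem norm_exp_I_mul (θ : ℝ) : ‖Complex.exp (Complex.I * θ)‖ = 1 := by
  rw [mul_comm, Complex.norm_exp_ofReal_mul_I]

/-- The denominators involve only `(tzq; q)_∞` and `(t/z; q)_∞` with `|t| < 1`. On `1 ≤ |z| ≤ 1/q`
both `|tzq|` and `|t/z|` are less than one, so the closed annulus swept by the shift `z ↦ z / q`
contains no pole. -/
theorem differentiableAt_nrPrimitive {q : ℝ} (hq0 : 0 < q) (hq1 : q < 1) {a b c d r z : ℂ}
    (ha : ‖a‖ < 1) (hb : ‖b‖ < 1) (hc : ‖c‖ < 1) (hd : ‖d‖ < 1) (hr : ‖r‖ < 1)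
    (h1 : 1 ≤ ‖z‖) (h2 : ‖z‖ ≤ q⁻¹) : DifferentiableAt ℂ (nrPrimitive q a b c d r) z := by
  have hq : ‖(q : ℂ)‖ < 1 := by simpa [abs_of_pos hq0] using hq1
  have hz0 : z ≠ 0 := by rintro rfl; norm_num at h1
  have hE := differentiable_qPochInf hq
  have D : ∀ g : ℂ → ℂ, DifferentiableAt ℂ g z →
      DifferentiableAt ℂ (fun z => qPochInf (g z) q) z := fun g hg =>
    (hE (g z)).comp z hg
  have n1 : ∀ t : ℂ, ‖t‖ < 1 → qPochInf (t * z * q) q ≠ 0 := fun t ht =>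
    qPochInf_ne_zero (by
      rw [norm_mul, norm_mul, Complex.norm_real, Real.norm_of_nonneg hq0.le, mul_assoc]
      refine (mul_le_of_le_one_right (norm_nonneg _) ?_).trans_lt ht
      rwa [← le_div_iff₀ hq0, one_div]) hq
  have n2 : ∀ t : ℂ, ‖t‖ < 1 → qPochInf (t * z⁻¹) q ≠ 0 := fun t ht =>
    qPochInf_ne_zero (norm_mul_inv_lt_one ht h1) hq
  have dinv : DifferentiableAt ℂ (fun z : ℂ => z⁻¹) z := differentiableAt_inv hz0
  have dp : ∀ t : ℂ, DifferentiableAt ℂ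
      (fun z => qPochInf (t * z * q) q * qPochInf (t * z⁻¹) q) z := fun t =>
    (D _ (by fun_prop)).mul (D _ (dinv.const_mul t))
  unfold nrPrimitive
  refine DifferentiableAt.div ?_ ?_ ?_
  · exact (((D _ (by fun_prop)).mul (D _ (dinv.pow 2))).mul (dp _)).mul dinv
  · exact ((((dp a).mul (dp b)).mul (dp c)).mul (dp d)).mul (dp r)
  · exact mul_ne_zero (mul_ne_zero (mul_ne_zero (mul_ne_zero (mul_ne_zero (n1 a ha) (n2 a ha))
      (mul_ne_zero (n1 b hb) (n2 b hb))) (mul_ne_zero (n1 c hc) (n2 c hc)))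
      (mul_ne_zero (n1 d hd) (n2 d hd))) (mul_ne_zero (n1 r hr) (n2 r hr))

theorem continuous_qPair {q : ℂ} (hq : ‖q‖ < 1) (t : ℂ) :
    Continuous fun θ : ℝ => qPair q t (Complex.exp (Complex.I * θ)) := by
  simp only [qPair, ← Complex.exp_neg]
  exact ((continuous_qPochInf hq).comp (by fun_prop)).mul
    ((continuous_qPochInf hq).comp (by fun_prop))

theorem continuous_nrWeight {q a b c d r : ℂ} (hq : ‖q‖ < 1)
    (ha : ‖a‖ < 1) (hb : ‖b‖ < 1) (hc : ‖c‖ < 1) (hd : ‖d‖ < 1) (hr : ‖r‖ < 1) :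
    Continuous fun θ : ℝ => nrWeight q a b c d r (Complex.exp (Complex.I * θ)) := by
  unfold nrWeight
  refine Continuous.div ?_ ?_ fun θ => ?_
  · refine Continuous.mul (Continuous.mul ((continuous_qPochInf hq).comp (by fun_prop)) ?_)
      (continuous_qPair hq _)
    simp only [← Complex.exp_neg]
    exact (continuous_qPochInf hq).comp (by fun_prop)
  · exact ((((continuous_qPair hq a).mul (continuous_qPair hq b)).mul (continuous_qPair hq c)).mul
      (continuous_qPair hq d)).mul (continuous_qPair hq r)
  · have hz := norm_exp_I_mul θ
    exact mul_ne_zero (mul_ne_zero (mul_ne_zero (mul_ne_zero (qPair_ne_zero hq ha hz)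
      (qPair_ne_zero hq hb hz)) (qPair_ne_zero hq hc hz)) (qPair_ne_zero hq hd hz))
      (qPair_ne_zero hq hr hz)

/-- The Nassrallah–Rahman integral over the full circle. -/
noncomputable def nrIntegral (q a b c d r : ℂ) : ℂ :=
  ∫ θ in (0 : ℝ)..2 * π, nrWeight q a b c d r (Complex.exp (Complex.I * θ))

theorem nrIntegral_contiguous {q : ℝ} (hq0 : 0 < q) (hq1 : q < 1) {a b c d r : ℂ}
    (ha : ‖a‖ < 1) (hb : ‖b‖ < 1) (hc : ‖c‖ < 1) (hd : ‖d‖ < 1) (hr : ‖r‖ < 1) :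
    nrIntegral q (a * q) b c d r *
      ((1 - a * c * d * r) * (1 - a * b * d * r) * (1 - a * b * c * r) * (1 - a * b * c * d)) =
    nrIntegral q a b c d r * ((1 - a * b) * (1 - a * c) * (1 - a * d) * (1 - a * r)) := by
  have hq : ‖(q : ℂ)‖ < 1 := by simpa [abs_of_pos hq0] using hq1
  have hqc : (q : ℂ) ≠ 0 := by exact_mod_cast hq0.ne'
  have haq : ‖a * q‖ < 1 := by simpa using norm_mul_pow_lt_one ha hq 1
  have hR : 1 ≤ q⁻¹ := (one_le_inv₀ hq0).2 hq1.le
  have hG := fun z h1 h2 => differentiableAt_nrPrimitive hq0 hq1 ha hb hc hd hr (z := z) h1 h2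
  have hcirc := integral_circle_eq hR hG
  have c1 : Continuous fun θ : ℝ => nrPrimitive q a b c d r (Complex.exp (Complex.I * θ)) := by
    rw [continuous_iff_continuousAt]
    intro θ
    have h := (hG (Complex.exp (Complex.I * θ)) (norm_exp_I_mul θ).ge
      ((norm_exp_I_mul θ).le.trans hR)).continuousAt
    exact ContinuousAt.comp (f := fun θ : ℝ => Complex.exp (Complex.I * θ)) h
      (Continuous.continuousAt (by fun_prop))
  have c2 : Continuous fun θ : ℝ =>
      nrPrimitive q a b c d r (Complex.exp (Complex.I * θ) * (q⁻¹ : ℝ)) := by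
    rw [continuous_iff_continuousAt]
    intro θ
    have hn : ‖Complex.exp (Complex.I * θ) * (q⁻¹ : ℝ)‖ = q⁻¹ := by
      rw [norm_mul, norm_exp_I_mul, one_mul, Complex.norm_real,
        Real.norm_of_nonneg (by positivity)]
    have h := (hG (Complex.exp (Complex.I * θ) * (q⁻¹ : ℝ)) (hR.trans hn.ge) hn.le).continuousAt
    exact ContinuousAt.comp (f := fun θ : ℝ => Complex.exp (Complex.I * θ) * (q⁻¹ : ℝ)) h
      (Continuous.continuousAt (by fun_prop))
  have w1 := continuous_nrWeight hq haq hb hc hd hr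
  have w2 := continuous_nrWeight hq ha hb hc hd hr
  rw [← sub_eq_zero]
  unfold nrIntegral
  rw [← intervalIntegral.integral_mul_const, ← intervalIntegral.integral_mul_const,
    ← intervalIntegral.integral_sub ((w1.intervalIntegrable _ _).mul_const _)
      ((w2.intervalIntegrable _ _).mul_const _)]
  simp_rw [nrWeight_contiguous hqc hq ha hb hc hd hr (norm_exp_I_mul _)]
  rw [intervalIntegral.integral_const_mul]
  push_cast at c2 hcirc
  rw [intervalIntegral.integral_sub (c1.intervalIntegrable _ _) (c2.intervalIntegrable _ _), hcirc]
  simp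

theorem nrIntegral_iterate {q : ℝ} (hq0 : 0 < q) (hq1 : q < 1) {a b c d r : ℂ}
    (ha : ‖a‖ < 1) (hb : ‖b‖ < 1) (hc : ‖c‖ < 1) (hd : ‖d‖ < 1) (hr : ‖r‖ < 1) (n : ℕ) :
    nrIntegral q (a * q ^ n) b c d r *
      (qPoch (a * c * d * r) q n * qPoch (a * b * d * r) q n * qPoch (a * b * c * r) q n *
        qPoch (a * b * c * d) q n) =
    nrIntegral q a b c d r *
      (qPoch (a * b) q n * qPoch (a * c) q n * qPoch (a * d) q n * qPoch (a * r) q n) := by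
  have hq : ‖(q : ℂ)‖ < 1 := by simpa [abs_of_pos hq0] using hq1
  induction n with
  | zero => simp [qPoch_zero]
  | succ n ih =>
    have h := nrIntegral_contiguous hq0 hq1 (norm_mul_pow_lt_one ha hq n) hb hc hd hr
    rw [show a * (q : ℂ) ^ n * q = a * q ^ (n + 1) by ring] at h
    simp only [qPoch_succ]
    linear_combination (qPoch (a * c * d * r) q n * qPoch (a * b * d * r) q n *
      qPoch (a * b * c * r) q n * qPoch (a * b * c * d) q n) * h +
      ((1 - a * b * q ^ n) * (1 - a * c * q ^ n) * (1 - a * d * q ^ n) * (1 - a * r * q ^ n)) * ih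

theorem norm_qPair_le {q t z : ℂ} (hq : ‖q‖ < 1) {ρ : ℝ} (ht : ‖t‖ ≤ ρ) (hz : ‖z‖ = 1) :
    ‖qPair q t z‖ ≤ Real.exp (ρ * (1 - ‖q‖)⁻¹) ^ 2 := by
  rw [qPair, norm_mul, pow_two]
  gcongr
  · exact norm_qPochInf_le hq (by simpa [hz] using ht)
  · exact norm_qPochInf_le hq (by simpa [hz] using ht)

theorem norm_inv_qPair_le {q t z : ℂ} (hq : ‖q‖ < 1) {ρ : ℝ} (hρ : ρ < 1) (ht : ‖t‖ ≤ ρ)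
    (hz : ‖z‖ = 1) :
    ‖(qPair q t z)⁻¹‖ ≤ Real.exp (ρ / (1 - ρ) * (1 - ‖q‖)⁻¹) ^ 2 := by
  rw [qPair, mul_inv, norm_mul, pow_two]
  gcongr
  · exact norm_inv_qPochInf_le hq hρ (by simpa [hz] using ht)
  · exact norm_inv_qPochInf_le hq hρ (by simpa [hz] using ht)

/-- Uniformity in `a` serves twice: for the limit `a q^n → 0`, and for termwise integration over the
parameters `a q^{2m}`. -/
theorem exists_norm_nrWeight_le {q b c d r : ℂ} (hq : ‖q‖ < 1)
    (hb : ‖b‖ < 1) (hc : ‖c‖ < 1) (hd : ‖d‖ < 1) (hr : ‖r‖ < 1) {ρ : ℝ} (hρ : ρ < 1) :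
    ∃ C : ℝ, ∀ a z : ℂ, ‖a‖ ≤ ρ → ‖z‖ = 1 → ‖nrWeight q a b c d r z‖ ≤ C := by
  refine ⟨Real.exp (1 * (1 - ‖q‖)⁻¹) * Real.exp (1 * (1 - ‖q‖)⁻¹) *
    Real.exp (1 * (1 - ‖q‖)⁻¹) ^ 2 *
    (Real.exp (ρ / (1 - ρ) * (1 - ‖q‖)⁻¹) ^ 2 * Real.exp (‖b‖ / (1 - ‖b‖) * (1 - ‖q‖)⁻¹) ^ 2 *
    Real.exp (‖c‖ / (1 - ‖c‖) * (1 - ‖q‖)⁻¹) ^ 2 * Real.exp (‖d‖ / (1 - ‖d‖) * (1 - ‖q‖)⁻¹) ^ 2 *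
    Real.exp (‖r‖ / (1 - ‖r‖) * (1 - ‖q‖)⁻¹) ^ 2), fun a z ha hz => ?_⟩
  have hA : ‖a * b * c * d * r‖ ≤ 1 := by
    simp only [norm_mul]
    exact mul_le_one₀ (mul_le_one₀ (mul_le_one₀ (mul_le_one₀ (ha.trans hρ.le) (norm_nonneg _) hb.le)
      (norm_nonneg _) hc.le) (norm_nonneg _) hd.le) (norm_nonneg _) hr.le
  have e : nrWeight q a b c d r z = qPochInf (z ^ 2) q * qPochInf (z⁻¹ ^ 2) q *
      qPair q (a * b * c * d * r) z * ((qPair q a z)⁻¹ * (qPair q b z)⁻¹ * (qPair q c z)⁻¹ *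
        (qPair q d z)⁻¹ * (qPair q r z)⁻¹) := by
    simp only [nrWeight, div_eq_mul_inv, mul_inv]
  have h1 : ‖qPochInf (z ^ 2) q‖ ≤ Real.exp (1 * (1 - ‖q‖)⁻¹) :=
    norm_qPochInf_le hq (by simp [hz])
  have h2 : ‖qPochInf (z⁻¹ ^ 2) q‖ ≤ Real.exp (1 * (1 - ‖q‖)⁻¹) :=
    norm_qPochInf_le hq (by simp [hz])
  have h3 := norm_qPair_le hq hA hz
  have h4 := norm_inv_qPair_le hq hρ ha hz
  have h5 := norm_inv_qPair_le hq hb le_rfl hz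
  have h6 := norm_inv_qPair_le hq hc le_rfl hz
  have h7 := norm_inv_qPair_le hq hd le_rfl hz
  have h8 := norm_inv_qPair_le hq hr le_rfl hz
  rw [e]
  simp only [norm_mul]
  gcongr

theorem tendsto_nrIntegral {q a b c d r : ℂ} (hq : ‖q‖ < 1)
    (ha : ‖a‖ < 1) (hb : ‖b‖ < 1) (hc : ‖c‖ < 1) (hd : ‖d‖ < 1) (hr : ‖r‖ < 1) :
    Tendsto (fun n : ℕ => nrIntegral q (a * q ^ n) b c d r) atTop
      (𝓝 (nrIntegral q 0 b c d r)) := by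
  obtain ⟨C, hC⟩ := exists_norm_nrWeight_le hq hb hc hd hr ha
  refine intervalIntegral.tendsto_integral_filter_of_dominated_convergence (fun _ => C)
    (.of_forall fun n => ?_) (.of_forall fun n => .of_forall fun θ _ => hC _ _ ?_ (norm_exp_I_mul θ))
    intervalIntegrable_const (.of_forall fun θ _ => ?_)
  · exact (continuous_nrWeight hq (norm_mul_pow_lt_one ha hq n) hb hc hd hr).aestronglyMeasurable
  · rw [norm_mul, norm_pow]
    exact mul_le_of_le_one_right (norm_nonneg _) (pow_le_one₀ (norm_nonneg _) hq.le)
  · have hz := norm_exp_I_mul θ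
    generalize Complex.exp (Complex.I * θ) = z at *
    have hE := continuous_qPochInf hq
    have hP : ∀ g : ℂ → ℂ, Continuous g → Continuous fun t => qPair q (g t) z := fun g hg =>
      (hE.comp (hg.mul continuous_const)).mul (hE.comp (hg.mul continuous_const))
    have hc : ContinuousAt (fun t => nrWeight q t b c d r z) 0 := by
      unfold nrWeight
      refine ContinuousAt.div ?_ ?_ ?_
      · exact (continuous_const.mul (hP _ (by fun_prop))).continuousAt
      · exact (((((hP _ continuous_id).mul continuous_const).mul continuous_const).mul
          continuous_const).mul continuous_const).continuousAt
      · exact mul_ne_zero (mul_ne_zero (mul_ne_zero (mul_ne_zero (qPair_ne_zero hq (by simp) hz)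
          (qPair_ne_zero hq hb hz)) (qPair_ne_zero hq hc hz)) (qPair_ne_zero hq hd hz))
          (qPair_ne_zero hq hr hz)
    refine hc.tendsto.comp ?_
    simpa using (tendsto_pow_atTop_nhds_zero_of_norm_lt_one hq).const_mul a

/-- The limit of `nrIntegral_iterate`. The integrand is symmetric in the parameters, so the new zero
can be put last and the next parameter treated in the same way. -/
theorem nrIntegral_reduce {q : ℝ} (hq0 : 0 < q) (hq1 : q < 1) {a b c d r : ℂ}
    (ha : ‖a‖ < 1) (hb : ‖b‖ < 1) (hc : ‖c‖ < 1) (hd : ‖d‖ < 1) (hr : ‖r‖ < 1) :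
    nrIntegral q a b c d r *
      (qPochInf (a * b) q * qPochInf (a * c) q * qPochInf (a * d) q * qPochInf (a * r) q) =
    nrIntegral q b c d r 0 *
      (qPochInf (a * c * d * r) q * qPochInf (a * b * d * r) q * qPochInf (a * b * c * r) q *
        qPochInf (a * b * c * d) q) := by
  have hq : ‖(q : ℂ)‖ < 1 := by simpa [abs_of_pos hq0] using hq1
  have e : nrIntegral q b c d r 0 = nrIntegral q 0 b c d r := by
    unfold nrIntegral nrWeight
    simp only [mul_zero, zero_mul, qPair_zero, mul_one, one_mul]
  have T := fun x => tendsto_qPoch x hq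
  have h1 := (tendsto_nrIntegral hq ha hb hc hd hr).mul ((((T (a * c * d * r)).mul
    (T (a * b * d * r))).mul (T (a * b * c * r))).mul (T (a * b * c * d)))
  have h2 := ((((T (a * b)).mul (T (a * c))).mul (T (a * d))).mul (T (a * r))).const_mul
    (nrIntegral q a b c d r)
  simp_rw [nrIntegral_iterate hq0 hq1 ha hb hc hd hr] at h1
  rw [e]
  exact tendsto_nhds_unique h2 h1

theorem norm_mul_lt_one {a b : ℂ} (ha : ‖a‖ < 1) (hb : ‖b‖ < 1) : ‖a * b‖ < 1 := by
  rw [norm_mul]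
  exact mul_lt_one_of_nonneg_of_lt_one_left (norm_nonneg _) ha hb.le

theorem nrIntegral_mul_eq {q : ℝ} (hq0 : 0 < q) (hq1 : q < 1) {a b c d r : ℂ}
    (ha : ‖a‖ < 1) (hb : ‖b‖ < 1) (hc : ‖c‖ < 1) (hd : ‖d‖ < 1) (hr : ‖r‖ < 1) :
    nrIntegral q a b c d r *
      (qPochInf (a * b) q * qPochInf (a * c) q * qPochInf (a * d) q * qPochInf (a * r) q *
       (qPochInf (b * c) q * qPochInf (b * d) q * qPochInf (b * r) q) *
       (qPochInf (c * d) q * qPochInf (c * r) q) * qPochInf (d * r) q) =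
    nrIntegral q 0 0 0 0 0 *
      (qPochInf (a * c * d * r) q * qPochInf (a * b * d * r) q * qPochInf (a * b * c * r) q *
        qPochInf (a * b * c * d) q * qPochInf (b * c * d * r) q) := by
  have h0 : ‖(0 : ℂ)‖ < 1 := by simp
  have h1 := nrIntegral_reduce hq0 hq1 ha hb hc hd hr
  have h2 := nrIntegral_reduce hq0 hq1 hb hc hd hr h0
  have h3 := nrIntegral_reduce hq0 hq1 hc hd hr h0 h0
  have h4 := nrIntegral_reduce hq0 hq1 hd hr h0 h0 h0
  have h5 := nrIntegral_reduce hq0 hq1 hr h0 h0 h0 h0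
  -- Once a parameter is zero, most fourfold products become trivial: the second reduction
  -- contributes only `(bcdr; q)_∞` on the right, the later ones nothing.
  simp only [mul_zero, qPochInf_zero_left, mul_one, one_mul] at h2 h3 h4 h5
  rw [h5] at h4
  rw [← h4]
  linear_combination (qPochInf (b * c) q * qPochInf (b * d) q * qPochInf (b * r) q *
       (qPochInf (c * d) q * qPochInf (c * r) q) * qPochInf (d * r) q) * h1 +
    (qPochInf (a * c * d * r) q * qPochInf (a * b * d * r) q * qPochInf (a * b * c * r) q *
        qPochInf (a * b * c * d) q * (qPochInf (c * d) q * qPochInf (c * r) q) *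
        qPochInf (d * r) q) * h2 +
    (qPochInf (a * c * d * r) q * qPochInf (a * b * d * r) q * qPochInf (a * b * c * r) q *
        qPochInf (a * b * c * d) q * qPochInf (b * c * d * r) q * qPochInf (d * r) q) * h3

/-- With base `q = p²`, the product `(qw, -qw, pw, -pw; q)_∞` collapses to `(qw²; q)_∞`. The
denominator thus cancels all of `(z², z⁻²; q)_∞` except the two leading factors. -/
theorem nrWeight_special {p z : ℂ} (hp : ‖p‖ < 1) (hz : ‖z‖ = 1) :
    nrWeight (p ^ 2) (p ^ 2) (-p ^ 2) p (-p) 0 z = (1 - z ^ 2) * (1 - z⁻¹ ^ 2) := by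
  have hq := norm_sq_lt_one hp
  have key : ∀ w : ℂ, qPochInf (p ^ 2 * w) (p ^ 2) * qPochInf (-p ^ 2 * w) (p ^ 2) *
      (qPochInf (p * w) (p ^ 2) * qPochInf (-p * w) (p ^ 2)) =
      qPochInf (w ^ 2 * p ^ 2) (p ^ 2) := fun w => by
    rw [show -p ^ 2 * w = -(p ^ 2 * w) by ring, show -p * w = -(p * w) by ring,
      qPochInf_mul_neg _ hq, qPochInf_mul_neg _ hq, ← qPochInf_sq_mul _ hq, mul_comm]
    congr 2 <;> ring
  have hw : ∀ w : ℂ, ‖w‖ = 1 → qPochInf (w ^ 2 * p ^ 2) (p ^ 2) ≠ 0 := fun w hw =>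
    qPochInf_ne_zero (by simpa [hw] using hq) hq
  have hz' : ‖z⁻¹‖ = 1 := by simp [hz]
  have e : qPair (p ^ 2) (p ^ 2) z * qPair (p ^ 2) (-p ^ 2) z * qPair (p ^ 2) p z *
      qPair (p ^ 2) (-p) z = qPochInf (z ^ 2 * p ^ 2) (p ^ 2) *
        qPochInf (z⁻¹ ^ 2 * p ^ 2) (p ^ 2) := by
    rw [← key z, ← key z⁻¹]
    unfold qPair
    ring
  rw [nrWeight, mul_zero, qPair_zero, e, qPochInf_step (z ^ 2) hq,
    qPochInf_step (z⁻¹ ^ 2) hq]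
  have n1 := hw z hz
  have n2 := hw z⁻¹ hz'
  generalize qPochInf (z ^ 2 * p ^ 2) (p ^ 2) = X at *
  generalize qPochInf (z⁻¹ ^ 2 * p ^ 2) (p ^ 2) = Y at *
  field_simp

theorem integral_one_sub_exp_sq :
    ∫ θ in (0 : ℝ)..2 * π, (1 - Complex.exp (Complex.I * θ) ^ 2) *
      (1 - (Complex.exp (Complex.I * θ))⁻¹ ^ 2) = (4 * π : ℂ) := by
  have e : ∀ θ : ℝ, (1 - Complex.exp (Complex.I * θ) ^ 2) *
      (1 - (Complex.exp (Complex.I * θ))⁻¹ ^ 2) = ((2 - 2 * Real.cos (2 * θ) : ℝ) : ℂ) := by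
    intro θ
    have h1 : Complex.exp (Complex.I * θ) ^ 2 = Complex.exp (2 * θ * Complex.I) := by
      rw [← Complex.exp_nat_mul]; congr 1; push_cast; ring
    have h2 : (Complex.exp (Complex.I * θ))⁻¹ ^ 2 = Complex.exp (-(2 * θ) * Complex.I) := by
      rw [inv_pow, h1, ← Complex.exp_neg]; congr 1; ring
    have h3 : Complex.exp (2 * θ * Complex.I) * Complex.exp (-(2 * θ) * Complex.I) = 1 := by
      rw [← Complex.exp_add]; simp
    have h4 := Complex.two_cos (2 * θ : ℂ)
    rw [h1, h2]
    push_cast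
    linear_combination h3 + h4
  simp_rw [e]
  rw [intervalIntegral.integral_ofReal, intervalIntegral.integral_sub (by simp)
    (Continuous.intervalIntegrable (by fun_prop) _ _), intervalIntegral.integral_const_mul,
    intervalIntegral.integral_comp_mul_left (fun x => Real.cos x) two_ne_zero, integral_cos,
    show 2 * (2 * π) = (4 : ℕ) * π by push_cast; ring, Real.sin_nat_mul_pi]
  simp
  ring

/-- The common constant is read off from `nrIntegral_mul_eq` at the parameters of
`nrWeight_special`, where the integral is `4π`; Euler's identity clears the leftover products. -/
theorem nrIntegral_zero {q : ℝ} (hq0 : 0 < q) (hq1 : q < 1) :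
    nrIntegral q 0 0 0 0 0 * qPochInf q q = 4 * π := by
  obtain ⟨p, hp0, rfl⟩ : ∃ p : ℝ, 0 < p ∧ p ^ 2 = q :=
    ⟨√q, Real.sqrt_pos.2 hq0, Real.sq_sqrt hq0.le⟩
  have hp1 : p < 1 := by nlinarith
  have hp : ‖(p : ℂ)‖ < 1 := by simpa [abs_of_pos hp0] using hp1
  have hq := norm_sq_lt_one hp
  have h := nrIntegral_mul_eq hq0 hq1 (a := (p : ℂ) ^ 2) (b := -(p : ℂ) ^ 2) (c := p) (d := -p)
    (r := 0) hq (by simpa using hq) hp (by simpa using hp) (by simp)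
  have h4 : nrIntegral ((p ^ 2 : ℝ) : ℂ) ((p : ℂ) ^ 2) (-(p : ℂ) ^ 2) p (-p) 0 = 4 * π := by
    unfold nrIntegral
    push_cast
    simp_rw [nrWeight_special hp (norm_exp_I_mul _)]
    exact integral_one_sub_exp_sq
  rw [h4] at h
  push_cast at h ⊢
  simp only [mul_zero, qPochInf_zero_left, mul_one, one_mul] at h
  generalize (p : ℂ) = p at *
  rw [show p ^ 2 * -p ^ 2 = -p ^ 2 * p ^ 2 by ring, show p ^ 2 * -p = -(p ^ 2 * p) by ring,
    show -p ^ 2 * p = -(p ^ 2 * p) by ring, show -p ^ 2 * -p = p ^ 2 * p by ring,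
    show p * -p = -p ^ 2 by ring, show -p ^ 2 * p ^ 2 * p * -p = p ^ 2 * p ^ 2 * p ^ 2 by ring] at h
  have e1 := qPochInf_mul_neg (p ^ 2 * p) hq
  rw [show (p ^ 2 * p) ^ 2 = p ^ 2 * (p ^ 2) ^ 2 by ring] at e1
  have e2 := qPochInf_step (p ^ 2) (norm_sq_lt_one hq)
  have e3 := qPochInf_step (-p ^ 2) hq
  have e4 := qPochInf_step (p ^ 2) hq
  have e5 := qPochInf_step (p ^ 2 * p ^ 2) hq
  have e6 := qPochInf_sq_mul_neg hq
  have n1 : 1 - p ^ 2 ≠ 0 := one_sub_ne_zero_of_norm_lt_one hq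
  have n2 : 1 - -p ^ 2 ≠ 0 := one_sub_ne_zero_of_norm_lt_one (by simpa using hq)
  rw [e4, e5]
  have h' : nrIntegral (p ^ 2) 0 0 0 0 0 * qPochInf (p ^ 2 * p ^ 2 * p ^ 2) (p ^ 2) =
      4 * π * (qPochInf (-p ^ 2 * p ^ 2) (p ^ 2) * qPochInf (-p ^ 2) (p ^ 2) *
        qPochInf (p ^ 2 * (p ^ 2) ^ 2) ((p ^ 2) ^ 2) ^ 2) := by
    rw [← h, ← e1]; ring
  -- The square of Euler's identity in base `p²`, with the leading factor split off both copies of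
  -- `(p²; p⁴)_∞` and one copy of `(-p²; p²)_∞`.
  have e7 : (1 - p ^ 2) ^ 2 * (1 - -p ^ 2) * (qPochInf (-p ^ 2 * p ^ 2) (p ^ 2) *
      qPochInf (-p ^ 2) (p ^ 2) * qPochInf (p ^ 2 * (p ^ 2) ^ 2) ((p ^ 2) ^ 2) ^ 2) = 1 := by
    linear_combination (qPochInf (p ^ 2) ((p ^ 2) ^ 2) * qPochInf (-p ^ 2) (p ^ 2) + 1) * e6 -
      (qPochInf (p ^ 2) ((p ^ 2) ^ 2) + (1 - p ^ 2) * qPochInf (p ^ 2 * (p ^ 2) ^ 2) ((p ^ 2) ^ 2)) *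
        qPochInf (-p ^ 2) (p ^ 2) ^ 2 * e2 -
      ((1 - p ^ 2) * qPochInf (p ^ 2 * (p ^ 2) ^ 2) ((p ^ 2) ^ 2)) ^ 2 *
        qPochInf (-p ^ 2) (p ^ 2) * e3
  refine mul_left_cancel₀ (mul_ne_zero n1 n2) ?_
  linear_combination (1 - p ^ 2) ^ 2 * (1 - -p ^ 2) * (1 - p ^ 2 * p ^ 2) * h' +
    4 * π * (1 - p ^ 2 * p ^ 2) * e7

end NassrallahRahman

/-! ### Folding the full circle onto `[0, π]`. -/

section NassrallahRahman

theorem nrWeight_inv (q a b c d r z : ℂ) : nrWeight q a b c d r z⁻¹ = nrWeight q a b c d r z := by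
  unfold nrWeight qPair
  simp only [inv_inv]
  ring

/-- The Nassrallah–Rahman integral. -/
theorem integral_nrWeight {q : ℝ} (hq0 : 0 < q) (hq1 : q < 1) {a b c d r : ℂ}
    (ha : ‖a‖ < 1) (hb : ‖b‖ < 1) (hc : ‖c‖ < 1) (hd : ‖d‖ < 1) (hr : ‖r‖ < 1) :
    ∫ θ in (0 : ℝ)..π, nrWeight q a b c d r (Complex.exp (Complex.I * θ)) =
      2 * π * (qPochInf (a * b * c * d) q * qPochInf (a * b * c * r) q *
        qPochInf (a * b * d * r) q * qPochInf (a * c * d * r) q * qPochInf (b * c * d * r) q) /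
      (qPochInf q q * (qPochInf (a * b) q * qPochInf (a * c) q * qPochInf (a * d) q *
        qPochInf (a * r) q) * (qPochInf (b * c) q * qPochInf (b * d) q * qPochInf (b * r) q *
        qPochInf (c * d) q * qPochInf (c * r) q * qPochInf (d * r) q)) := by
  have hq : ‖(q : ℂ)‖ < 1 := by simpa [abs_of_pos hq0] using hq1
  set f : ℝ → ℂ := fun θ => nrWeight q a b c d r (Complex.exp (Complex.I * θ)) with hf
  have hcont : Continuous f := continuous_nrWeight hq ha hb hc hd hr
  have hrefl : ∀ θ : ℝ, f (2 * π - θ) = f θ := fun θ => by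
    simp only [hf]
    rw [← nrWeight_inv, ← Complex.exp_neg]
    congr 1
    rw [Complex.exp_eq_exp_iff_exists_int]
    exact ⟨-1, by push_cast; ring⟩
  have h1 : ∫ θ in π..2 * π, f θ = ∫ θ in (0 : ℝ)..π, f θ := by
    have := intervalIntegral.integral_comp_sub_left f (2 * π) (a := 0) (b := π)
    rw [show 2 * π - π = π by ring, sub_zero] at this
    rw [← this]
    simp_rw [hrefl]
  have h2 : nrIntegral q a b c d r = 2 * ∫ θ in (0 : ℝ)..π, f θ := by
    rw [nrIntegral, ← intervalIntegral.integral_add_adjacent_intervals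
      (hcont.intervalIntegrable 0 π) (hcont.intervalIntegrable π (2 * π)), h1, two_mul]
  have h3 := nrIntegral_mul_eq hq0 hq1 ha hb hc hd hr
  have h4 := nrIntegral_zero hq0 hq1
  have n : ∀ x y : ℂ, ‖x‖ < 1 → ‖y‖ < 1 → qPochInf (x * y) q ≠ 0 := fun x y hx hy =>
    qPochInf_ne_zero (norm_mul_lt_one hx hy) hq
  have := qPochInf_ne_zero hq hq
  have := n a b ha hb; have := n a c ha hc; have := n a d ha hd; have := n a r ha hr
  have := n b c hb hc; have := n b d hb hd; have := n b r hb hr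
  have := n c d hc hd; have := n c r hc hr; have := n d r hd hr
  rw [eq_div_iff (by positivity)]
  rw [h2] at h3
  refine mul_left_cancel₀ (two_ne_zero (α := ℂ)) ?_
  linear_combination qPochInf q q * h3 + (qPochInf (a * c * d * r) q * qPochInf (a * b * d * r) q *
    qPochInf (a * b * c * r) q * qPochInf (a * b * c * d) q * qPochInf (b * c * d * r) q) * h4

end NassrallahRahman

/-! ### Summing the double series by rows and by columns. -/

section BaileyTransform

theorem qPoch_mul_neg (x q : ℂ) (n : ℕ) :
    qPoch x q n * qPoch (-x) q n = qPoch (x ^ 2) (q ^ 2) n := by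
  simp only [qPoch, ← Finset.prod_mul_distrib]
  refine Finset.prod_congr rfl fun k _ => ?_
  ring

theorem qPoch_two_mul (x q : ℂ) (m : ℕ) :
    qPoch x q (2 * m) = qPoch x (q ^ 2) m * qPoch (x * q) (q ^ 2) m := by
  induction m with
  | zero => simp [qPoch_zero]
  | succ m ih =>
    rw [show 2 * (m + 1) = 2 * m + 1 + 1 by ring, qPoch_succ, qPoch_succ, ih, qPoch_succ,
      qPoch_succ]
    ring

/-- Only `|qα| < 1` is available, as `α` itself may be large. Since `3m² - m ≥ m`, one factor `q`
per index can be paired with each `α`, giving a geometric bound. -/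
theorem summable_norm_baileyCoeff {q α : ℂ} (hq : ‖q‖ < 1) (hqα : ‖q * α‖ < 1) :
    Summable fun m => ‖baileyCoeff q α m‖ := by
  have hq2 := norm_sq_lt_one hq
  refine Summable.of_nonneg_of_le (fun _ => norm_nonneg _) (fun m => ?_)
    ((summable_geometric_of_lt_one (norm_nonneg _) hqα).mul_left
      ((1 + ‖α‖) * Real.exp (‖α‖ * (1 - ‖q ^ 2‖)⁻¹) *
        (‖(1 - α)⁻¹‖ * Real.exp (‖q ^ 2‖ / (1 - ‖q ^ 2‖) * (1 - ‖q ^ 2‖)⁻¹))))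
  have h1 : ‖1 - α * q ^ (4 * m)‖ ≤ 1 + ‖α‖ := by
    refine (norm_sub_le _ _).trans ?_
    rw [norm_one, norm_mul, norm_pow]
    gcongr
    exact mul_le_of_le_one_right (norm_nonneg _) (pow_le_one₀ (norm_nonneg _) hq.le)
  have h2 := norm_qPoch_le α hq2 le_rfl m
  have h3 := norm_inv_qPoch_le hq2 hq2 le_rfl m
  have h4 : ‖(-α) ^ m * q ^ (3 * m ^ 2 - m)‖ ≤ ‖q * α‖ ^ m := by
    have e : 3 * m ^ 2 - m = m + (3 * m ^ 2 - 2 * m) := by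
      have : m ≤ m ^ 2 := Nat.le_self_pow two_ne_zero m
      lia
    rw [e, pow_add, ← mul_assoc, ← mul_pow, norm_mul, norm_pow, norm_pow,
      show -α * q = -(q * α) by ring, norm_neg]
    exact mul_le_of_le_one_right (by positivity) (pow_le_one₀ (norm_nonneg _) hq.le)
  calc ‖baileyCoeff q α m‖ = ‖1 - α * q ^ (4 * m)‖ * ‖qPoch α (q ^ 2) m‖ *
        (‖(1 - α)⁻¹‖ * ‖(qPoch (q ^ 2) (q ^ 2) m)⁻¹‖) * ‖(-α) ^ m * q ^ (3 * m ^ 2 - m)‖ := by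
        rw [baileyCoeff, div_eq_mul_inv, mul_inv]
        simp only [norm_mul]
        ring
    _ ≤ _ := by gcongr

/-- The double series linking the `₃φ₂` series (row sums) to the even very-well-poised series
(column sums). -/
noncomputable def baileyTerm (q α x y s : ℂ) (n m : ℕ) : ℂ :=
  qPoch x q n * qPoch y q n * s ^ n *
    (baileyCoeff q α m * qPoch (q ^ n) q⁻¹ (2 * m) / (qPoch q q n * qPoch (α * q) q (n + 2 * m)))

theorem baileyTerm_eq_zero {q : ℂ} (hq0 : q ≠ 0) (α x y s : ℂ) {n m : ℕ} (h : n < 2 * m) :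
    baileyTerm q α x y s n m = 0 := by
  simp [baileyTerm, qPoch_pow_inv_eq_zero hq0 h]

theorem baileyTerm_add {q : ℂ} (hq0 : q ≠ 0) (hq : ‖q‖ < 1) (α x y s : ℂ) (k m : ℕ) :
    baileyTerm q α x y s (k + 2 * m) m = qPoch x q (k + 2 * m) * qPoch y q (k + 2 * m) *
      s ^ (k + 2 * m) * (baileyCoeff q α m / (qPoch q q k * qPoch (α * q) q (k + 4 * m))) := by
  have h := qPoch_self_add hq0 k (2 * m)
  have h1 : qPoch (q ^ (k + 2 * m)) q⁻¹ (2 * m) ≠ 0 := by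
    intro h0
    rw [h0, mul_zero] at h
    exact qPoch_ne_zero hq hq _ h
  have h2 := qPoch_ne_zero hq hq k
  rw [baileyTerm, h, show k + 2 * m + 2 * m = k + 4 * m by ring]
  generalize qPoch (q ^ (k + 2 * m)) q⁻¹ (2 * m) = D at *
  congr 1
  rw [mul_right_comm, mul_div_mul_right _ _ h1]

/-- Domination by a constant times `|s|^n |A_m|`. The base-`q⁻¹` factor is unbounded on its own, so
it is first cancelled against `(q; q)_n` by `baileyTerm_add`. -/
theorem summable_baileyTerm {q α x y s : ℂ} (hq0 : q ≠ 0) (hq : ‖q‖ < 1) (hqα : ‖q * α‖ < 1)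
    (hs : ‖s‖ < 1) : Summable fun p : ℕ × ℕ => baileyTerm q α x y s p.1 p.2 := by
  have hαq : ‖α * q‖ < 1 := by rwa [mul_comm]
  have hB := ((summable_geometric_of_lt_one (norm_nonneg _) hs).mul_left
    (Real.exp (‖x‖ * (1 - ‖q‖)⁻¹) * Real.exp (‖y‖ * (1 - ‖q‖)⁻¹) *
      (Real.exp (‖q‖ / (1 - ‖q‖) * (1 - ‖q‖)⁻¹) *
        Real.exp (‖α * q‖ / (1 - ‖α * q‖) * (1 - ‖q‖)⁻¹)))).mul_of_nonneg
    (summable_norm_baileyCoeff hq hqα) (fun _ => by positivity) (fun _ => norm_nonneg _)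
  refine .of_norm_bounded hB fun ⟨n, m⟩ => ?_
  dsimp only
  rcases lt_or_ge n (2 * m) with h | h
  · rw [baileyTerm_eq_zero hq0 α x y s h, norm_zero]
    positivity
  · obtain ⟨k, rfl⟩ := Nat.exists_eq_add_of_le' h
    have h1 := norm_qPoch_le x hq le_rfl (k + 2 * m)
    have h2 := norm_qPoch_le y hq le_rfl (k + 2 * m)
    have h3 := norm_inv_qPoch_le hq hq le_rfl k
    have h4 := norm_inv_qPoch_le hq hαq le_rfl (k + 4 * m)
    calc ‖baileyTerm q α x y s (k + 2 * m) m‖ = ‖qPoch x q (k + 2 * m)‖ *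
          ‖qPoch y q (k + 2 * m)‖ * (‖(qPoch q q k)⁻¹‖ * ‖(qPoch (α * q) q (k + 4 * m))⁻¹‖) *
          ‖s‖ ^ (k + 2 * m) * ‖baileyCoeff q α m‖ := by
          rw [baileyTerm_add hq0 hq, div_eq_mul_inv, mul_inv]
          simp only [norm_mul, norm_pow]
          ring
      _ ≤ _ := by gcongr

theorem hasSum_baileyTerm_row {q α : ℂ} (hq0 : q ≠ 0) (hq : ‖q‖ < 1) (hα : α ≠ 1)
    (hqα : ‖q * α‖ < 1) (x y s : ℂ) (n : ℕ) :
    HasSum (baileyTerm q α x y s n)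
      (qPoch x q n * qPoch y q n * s ^ n / (qPoch q q n * qPoch (q * α) (q ^ 2) n)) := by
  have hαq : ‖α * q‖ < 1 := by rwa [mul_comm]
  have h : HasSum (baileyTerm q α x y s n)
      (∑ m ∈ Finset.range (n + 1), baileyTerm q α x y s n m) :=
    hasSum_sum_of_ne_finset_zero fun m hm => by
      rw [Finset.mem_range] at hm
      exact baileyTerm_eq_zero hq0 α x y s (by lia)
  convert h using 1
  have h1 := sum_baileyCoeff hq0 hq hα hqα n n (by lia)
  have n1 := qPoch_ne_zero hq hq n
  have n2 := qPoch_ne_zero hαq hq n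
  have h2 : ∀ m, baileyTerm q α x y s n m = qPoch x q n * qPoch y q n * s ^ n /
      (qPoch q q n * qPoch (α * q) q n) * (baileyCoeff q α m *
        qPoch (q ^ n) q⁻¹ (2 * m) / qPoch (α * q * q ^ n) q (2 * m)) := fun m => by
    rw [baileyTerm, qPoch_add, div_mul_div_comm, mul_div_assoc', mul_assoc (qPoch q q n)]
  simp_rw [h2]
  rw [← Finset.mul_sum, h1, div_mul_div_comm,
    ← mul_div_mul_right _ (qPoch q q n * qPoch (q * α) (q ^ 2) n) n2]
  congr 1
  ring

/-- The terms with `n < 2m` vanish; after shifting by `2m` the rest is a `q`-Gauss series in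
`xq^{2m}`, `yq^{2m}`. Its lower parameter must be `αq^{4m+1}`, which is the condition `xys = qα`. -/
theorem hasSum_baileyTerm_column {q α x y s : ℂ} (hq0 : q ≠ 0) (hq : ‖q‖ < 1)
    (hqα : ‖q * α‖ < 1) (hs : ‖s‖ < 1) (hxys : x * y * s = q * α) (m : ℕ) :
    HasSum (fun n => baileyTerm q α x y s n m)
      (baileyCoeff q α m * (qPoch x q (2 * m) * qPoch y q (2 * m) * s ^ (2 * m)) *
        (qPochInf (x * s * q ^ (2 * m)) q * qPochInf (y * s * q ^ (2 * m)) q) /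
        (qPochInf (q * α) q * qPochInf s q)) := by
  have hαq : ‖α * q‖ < 1 := by rwa [mul_comm]
  have e0 : x * q ^ (2 * m) * (y * q ^ (2 * m)) * s = α * q * q ^ (4 * m) := by
    rw [mul_comm α, ← hxys]; ring
  have hG := hasSum_qGaussTerm (x := x * q ^ (2 * m)) (y := y * q ^ (2 * m)) hq hs
    (by rw [e0]; exact norm_mul_pow_lt_one hαq hq _)
  rw [e0] at hG
  rw [← hasSum_nat_add_iff' (2 * m), Finset.sum_eq_zero fun n hn =>
    baileyTerm_eq_zero hq0 α x y s (Finset.mem_range.1 hn), sub_zero]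
  have n1 := qPoch_ne_zero hαq hq (4 * m)
  have n2 : qPochInf (α * q * q ^ (4 * m)) q ≠ 0 :=
    qPochInf_ne_zero (norm_mul_pow_lt_one hαq hq _) hq
  convert! hG.mul_left (baileyCoeff q α m * (qPoch x q (2 * m) * qPoch y q (2 * m) * s ^ (2 * m)) /
    qPoch (α * q) q (4 * m)) using 1
  · funext k
    rw [baileyTerm_add hq0 hq, qGaussTerm, e0, add_comm k, add_comm k, qPoch_add, qPoch_add,
      qPoch_add, pow_add, div_mul_div_comm, mul_div_assoc']
    congr 1 <;> ring
  · rw [mul_comm q α, qPochInf_eq_qPoch_mul (α * q) hq (4 * m), div_mul_div_comm,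
      mul_right_comm x, mul_right_comm y, mul_assoc (qPoch (α * q) q (4 * m))]

/-- The sum of the `₃φ₂` series, obtained by summing `baileyTerm` by columns. -/
theorem exists_hasSum_bailey {q α x y s : ℂ} (hq0 : q ≠ 0) (hq : ‖q‖ < 1) (hα : α ≠ 1)
    (hqα : ‖q * α‖ < 1) (hs : ‖s‖ < 1) (hxys : x * y * s = q * α) :
    ∃ V : ℂ, HasSum (fun n => qPoch x q n * qPoch y q n * s ^ n /
        (qPoch q q n * qPoch (q * α) (q ^ 2) n)) V ∧
      HasSum (fun m => baileyCoeff q α m * (qPoch x q (2 * m) * qPoch y q (2 * m) * s ^ (2 * m)) *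
        (qPochInf (x * s * q ^ (2 * m)) q * qPochInf (y * s * q ^ (2 * m)) q) /
        (qPochInf (q * α) q * qPochInf s q)) V := by
  have hT := (summable_baileyTerm (x := x) (y := y) hq0 hq hqα hs).hasSum
  refine ⟨_, hT.prod_fiberwise fun n => hasSum_baileyTerm_row hq0 hq hα hqα x y s n, ?_⟩
  have hT' := (Equiv.prodComm ℕ ℕ).hasSum_iff.2 hT
  exact hT'.prod_fiberwise fun m => hasSum_baileyTerm_column hq0 hq hqα hs hxys m

end BaileyTransform

/-! ### Matching the transformed series with the integrand and the right-hand side. -/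

section Integral

theorem qHyperTerm_sqrt {q α σ : ℂ} (hσ : σ ^ 2 = q * α) (x y s : ℂ) (n : ℕ) :
    qHyperTerm ![x, y, 0] ![σ, -σ] q s n =
      qPoch x q n * qPoch y q n * s ^ n / (qPoch q q n * qPoch (q * α) (q ^ 2) n) := by
  simp [qHyperTerm, Fin.prod_univ_three, qPoch_zero_left, qPoch_mul_neg, hσ]

theorem qPair_eq_qPoch_mul {q : ℂ} (hq : ‖q‖ < 1) (t z : ℂ) (n : ℕ) :
    qPair q t z = qPoch (t * z) q n * qPoch (t * z⁻¹) q n * qPair q (t * q ^ n) z := by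
  rw [qPair, qPair, qPochInf_eq_qPoch_mul (t * z) hq n, qPochInf_eq_qPoch_mul (t * z⁻¹) hq n,
    mul_right_comm t z, mul_right_comm t z⁻¹]
  ring

/-- The factor `(az, a/z; q)_{2m}` shifts `a` to `aq^{2m}` in the denominator of the weight, while
the two infinite products from the `q`-Gauss sum form the numerator pair with parameter
`aq^{2m}bcdr`. -/
theorem hasSum_weightedIntegrand {q a b c d r α σ : ℂ} (hq0 : q ≠ 0) (hq : ‖q‖ < 1)
    (ha : ‖a‖ < 1) (hs : ‖b * c * d * r‖ < 1) (hα : q * α = a ^ 2 * b * c * d * r) (hα1 : α ≠ 1)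
    (hqα : ‖q * α‖ < 1) (hσ : σ ^ 2 = q * α) (θ : ℝ) :
    HasSum (fun m => baileyCoeff q α m * (b * c * d * r) ^ (2 * m) /
        (qPochInf (q * α) q * qPochInf (b * c * d * r) q) *
        nrWeight q (a * q ^ (2 * m)) b c d r (Complex.exp (Complex.I * θ)))
      (weightedIntegrand q a b c d r σ θ) := by
  set z := Complex.exp (Complex.I * θ) with hz
  have hz1 : ‖z‖ = 1 := norm_exp_I_mul θ
  have hz0 : z ≠ 0 := Complex.exp_ne_zero _
  have hzi : Complex.exp (-(Complex.I * θ)) = z⁻¹ := Complex.exp_neg _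
  obtain ⟨V, h1, h2⟩ := exists_hasSum_bailey (x := a * z) (y := a * z⁻¹) (s := b * c * d * r)
    hq0 hq hα1 hqα hs (by rw [hα]; field_simp)
  have e1 : qHyper ![a * z, a * z⁻¹, 0] ![σ, -σ] q (b * c * d * r) = V := by
    rw [qHyper, ← h1.tsum_eq]
    exact tsum_congr fun n => qHyperTerm_sqrt hσ _ _ _ n
  have e2 : ∀ t : ℂ, hProd (Real.cos θ) t q = qPair q t z := fun t => by
    rw [hProd_cos θ t q hq, ← hz, hzi]
    simp [qPochsInf, qPair]
  have e3 : hProd (Real.cos (2 * θ)) 1 q = qPochInf (z ^ 2) q * qPochInf (z⁻¹ ^ 2) q := by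
    have e : Complex.I * ((2 * θ : ℝ) : ℂ) = (2 : ℕ) * (Complex.I * θ) := by push_cast; ring
    rw [hProd_cos _ _ q hq, Complex.exp_neg, e, Complex.exp_nat_mul, ← hz]
    simp [qPochsInf]
  have e4 : weightedIntegrand q a b c d r σ θ = qPochInf (z ^ 2) q * qPochInf (z⁻¹ ^ 2) q /
      (qPair q a z * qPair q b z * qPair q c z * qPair q d z * qPair q r z) * V := by
    rw [weightedIntegrand, ← hz, hzi, e1, e3]
    simp only [hProds, List.map_cons, List.map_nil, List.prod_cons, List.prod_nil, e2, mul_one,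
      mul_assoc]
  rw [e4]
  convert! h2.mul_left (qPochInf (z ^ 2) q * qPochInf (z⁻¹ ^ 2) q /
    (qPair q a z * qPair q b z * qPair q c z * qPair q d z * qPair q r z)) using 1
  funext m
  have n1 := qPair_ne_zero hq ha hz1
  have e5 := qPair_eq_qPoch_mul hq a z (2 * m)
  rw [nrWeight, e5]
  rw [e5] at n1
  have e6 : qPair q (a * q ^ (2 * m) * b * c * d * r) z =
      qPochInf (a * z * (b * c * d * r) * q ^ (2 * m)) q *
        qPochInf (a * z⁻¹ * (b * c * d * r) * q ^ (2 * m)) q := by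
    rw [qPair]; congr 2 <;> ring
  rw [e6]
  have n2 := left_ne_zero_of_mul n1
  have n3 := left_ne_zero_of_mul n2
  have n4 := right_ne_zero_of_mul n2
  generalize qPoch (a * z) q (2 * m) = X at *
  generalize qPoch (a * z⁻¹) q (2 * m) = Y at *
  simp only [div_eq_mul_inv, mul_inv]
  linear_combination (-(baileyCoeff q α m * (b * c * d * r) ^ (2 * m) *
    ((qPochInf (q * α) q)⁻¹ * (qPochInf (b * c * d * r) q)⁻¹) * (qPochInf (z ^ 2) q *
    qPochInf (z⁻¹ ^ 2) q) * (qPochInf (a * z * (b * c * d * r) * q ^ (2 * m)) q *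
        qPochInf (a * z⁻¹ * (b * c * d * r) * q ^ (2 * m)) q) *
    ((qPair q (a * q ^ (2 * m)) z)⁻¹ * (qPair q b z)⁻¹ * (qPair q c z)⁻¹ * (qPair q d z)⁻¹ *
      (qPair q r z)⁻¹))) * (X * X⁻¹ * mul_inv_cancel₀ n4 + mul_inv_cancel₀ n3)

/-- Splitting `(α; q)_{2m}` and `(q; q)_{2m}` into base-`q²` halves cancels `(qα; q²)_m` and `(q;
q²)_m`, which leaves `baileyCoeff`. -/
theorem evenSeriesTerm_eq {q α : ℂ} (hq : ‖q‖ < 1) (hqα : ‖q * α‖ < 1) (a b c d r : ℂ) (m : ℕ) :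
    evenSeriesTerm q a b c d r α m = baileyCoeff q α m * (b * c * d * r) ^ (2 * m) *
      (qPoch (a * b) q (2 * m) * qPoch (a * c) q (2 * m) * qPoch (a * d) q (2 * m) *
        qPoch (a * r) q (2 * m)) /
      (qPoch (a * b * c * d) q (2 * m) * qPoch (a * b * c * r) q (2 * m) *
        qPoch (a * b * d * r) q (2 * m) * qPoch (a * c * d * r) q (2 * m)) := by
  have hq2 := norm_sq_lt_one hq
  have n1 := qPoch_ne_zero hq hq2 m
  have n2 := qPoch_ne_zero hqα hq2 m
  rw [evenSeriesTerm, baileyCoeff]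
  simp only [qPochs, List.map_cons, List.map_nil, List.prod_cons, List.prod_nil, mul_one]
  rw [qPoch_two_mul α, qPoch_two_mul q, mul_comm α q, ← pow_two]
  generalize qPoch q (q ^ 2) m = X at *
  generalize qPoch (q * α) (q ^ 2) m = Y at *
  simp only [div_eq_mul_inv, mul_inv]
  generalize (b * c * d * r) ^ (2 * m) = S
  generalize 1 - α * q ^ (4 * m) = u
  generalize (1 - α)⁻¹ = v
  generalize (-α) ^ m = w
  generalize q ^ (3 * m ^ 2 - m) = t
  generalize qPoch α (q ^ 2) m = A
  generalize (qPoch (q ^ 2) (q ^ 2) m)⁻¹ = B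
  generalize qPoch (a * b) q (2 * m) = A1
  generalize qPoch (a * c) q (2 * m) = A2
  generalize qPoch (a * d) q (2 * m) = A3
  generalize qPoch (a * r) q (2 * m) = A4
  generalize (qPoch (a * b * c * d) q (2 * m))⁻¹ = B1
  generalize (qPoch (a * b * c * r) q (2 * m))⁻¹ = B2
  generalize (qPoch (a * b * d * r) q (2 * m))⁻¹ = B3
  generalize (qPoch (a * c * d * r) q (2 * m))⁻¹ = B4
  linear_combination u * A * v * B * w * t * S * A1 * A2 * A3 * A4 * B1 * B2 * B3 * B4 *
    (X * X⁻¹ * mul_inv_cancel₀ n2 + mul_inv_cancel₀ n1)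

end Integral

/-! ### Termwise integration and conclusion. -/

theorem theorem6p5 (q : ℝ) (hq0 : 0 < q) (hq1 : q < 1) (a b c d r α σ : ℂ)
    (ha : ‖a‖ < 1) (hb : ‖b‖ < 1) (hc : ‖c‖ < 1) (hd : ‖d‖ < 1) (hr : ‖r‖ < 1)
    (hα : α = a ^ 2 * b * c * d * r / q) (hα1 : α ≠ 1) (hσ : σ ^ 2 = q * α) :
    (∀ θ : ℝ, Summable
      (qHyperTerm ![a * Complex.exp (Complex.I * θ), a * Complex.exp (-(Complex.I * θ)), 0]
        ![σ, -σ] q (b * c * d * r))) ∧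
    IntervalIntegrable (weightedIntegrand q a b c d r σ) volume 0 Real.pi ∧
    Summable (evenSeriesTerm q a b c d r α) ∧
    ∫ θ in (0 : ℝ)..Real.pi, weightedIntegrand q a b c d r σ θ =
      2 * (Real.pi : ℂ) *
        qPochsInf [a * b * c * d, a * b * c * r, a * b * d * r, a * c * d * r] q /
        qPochsInf [(q : ℂ), a * b, a * c, a * d, a * r, b * c, b * d, b * r, c * d, c * r, d * r,
          a ^ 2 * b * c * d * r] q *
      ∑' n : ℕ, evenSeriesTerm q a b c d r α n := by
  have hq : ‖(q : ℂ)‖ < 1 := by simpa [abs_of_pos hq0] using hq1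
  have hqc : (q : ℂ) ≠ 0 := by exact_mod_cast hq0.ne'
  have hqa : q * α = a ^ 2 * b * c * d * r := by rw [hα]; field_simp
  have hbc := norm_mul_lt_one hb hc
  have hs : ‖b * c * d * r‖ < 1 := norm_mul_lt_one (norm_mul_lt_one hbc hd) hr
  have hqα : ‖q * α‖ < 1 := by
    rw [hqa]
    exact norm_mul_lt_one (norm_mul_lt_one (norm_mul_lt_one (norm_mul_lt_one
      (norm_sq_lt_one ha) hb) hc) hd) hr
  set κ : ℂ := 2 * (Real.pi : ℂ) *
        qPochsInf [a * b * c * d, a * b * c * r, a * b * d * r, a * c * d * r] q /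
        qPochsInf [(q : ℂ), a * b, a * c, a * d, a * r, b * c, b * d, b * r, c * d, c * r, d * r,
          a ^ 2 * b * c * d * r] q with hκ
  set s := b * c * d * r with hsdef
  have hA : ∀ m : ℕ, ‖a * (q : ℂ) ^ (2 * m)‖ < 1 := fun m => norm_mul_pow_lt_one ha hq _
  set C : ℕ → ℂ := fun m => baileyCoeff q α m * s ^ (2 * m) /
    (qPochInf (q * α) q * qPochInf s q) with hC
  have hCs : Summable fun m => ‖C m‖ := by
    refine Summable.of_nonneg_of_le (fun _ => norm_nonneg _) (fun m => ?_)
      ((summable_norm_baileyCoeff hq hqα).mul_right ‖(qPochInf (q * α) q * qPochInf s q)⁻¹‖)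
    rw [hC]
    dsimp only
    rw [div_eq_mul_inv, norm_mul, norm_mul, norm_pow]
    gcongr
    exact mul_le_of_le_one_right (norm_nonneg _) (pow_le_one₀ (norm_nonneg _) hs.le)
  -- The bound is taken with `ρ = ‖a‖`, so that one `M` covers every parameter `a q^{2m}`.
  obtain ⟨M, hM⟩ := exists_norm_nrWeight_le hq hb hc hd hr ha
  have hbound : ∀ (m : ℕ) (θ : ℝ),
      ‖C m * nrWeight q (a * q ^ (2 * m)) b c d r (Complex.exp (Complex.I * θ))‖ ≤
        ‖C m‖ * M := fun m θ => by
    rw [norm_mul]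
    gcongr
    refine hM _ _ ?_ (norm_exp_I_mul θ)
    rw [norm_mul, norm_pow]
    exact mul_le_of_le_one_right (norm_nonneg _) (pow_le_one₀ (norm_nonneg _) hq.le)
  have hcont : ∀ m : ℕ, Continuous fun θ : ℝ =>
      C m * nrWeight q (a * q ^ (2 * m)) b c d r (Complex.exp (Complex.I * θ)) := fun m =>
    continuous_const.mul (continuous_nrWeight hq (hA m) hb hc hd hr)
  have hsum : ∀ θ : ℝ, HasSum (fun m =>
      C m * nrWeight q (a * q ^ (2 * m)) b c d r (Complex.exp (Complex.I * θ)))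
      (weightedIntegrand q a b c d r σ θ) := fun θ =>
    hasSum_weightedIntegrand hqc hq ha hs hqa hα1 hqα hσ θ
  have hwcont : Continuous (weightedIntegrand q a b c d r σ) := by
    have := continuous_tsum hcont (hCs.mul_right M) hbound
    simpa only [(hsum _).tsum_eq] using this
  have hint := intervalIntegral.hasSum_integral_of_dominated_convergence (μ := volume) (a := 0)
    (b := π) (fun m _ => ‖C m‖ * M) (fun m => (hcont m).aestronglyMeasurable)
    (fun m => .of_forall fun θ _ => hbound m θ)
    (.of_forall fun _ _ => hCs.mul_right M) (by simp) (.of_forall fun θ _ => hsum θ)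
  have n : ∀ x y : ℂ, ‖x‖ < 1 → ‖y‖ < 1 → qPochInf (x * y) q ≠ 0 := fun x y hx hy =>
    qPochInf_ne_zero (norm_mul_lt_one hx hy) hq
  have hab := norm_mul_lt_one ha hb
  have hac := norm_mul_lt_one ha hc
  have nq := qPochInf_ne_zero hq hq
  have nqα := qPochInf_ne_zero hqα hq
  have ns := qPochInf_ne_zero hs hq
  have m1 := n _ _ (norm_mul_lt_one hab hc) hd
  have m2 := n _ _ (norm_mul_lt_one hab hc) hr
  have m3 := n _ _ (norm_mul_lt_one hab hd) hr
  have m4 := n _ _ (norm_mul_lt_one hac hd) hr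
  have n1 := n a b ha hb; have n2 := n a c ha hc; have n3 := n a d ha hd; have n4 := n a r ha hr
  have n5 := n b c hb hc; have n6 := n b d hb hd; have n7 := n b r hb hr
  have n8 := n c d hc hd; have n9 := n c r hc hr; have n10 := n d r hd hr
  have hκ' : κ = 2 * π * (qPochInf (a * b * c * d) q * qPochInf (a * b * c * r) q *
      qPochInf (a * b * d * r) q * qPochInf (a * c * d * r) q) /
      (qPochInf q q * (qPochInf (a * b) q * qPochInf (a * c) q * qPochInf (a * d) q *
        qPochInf (a * r) q) * (qPochInf (b * c) q * qPochInf (b * d) q * qPochInf (b * r) q *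
        qPochInf (c * d) q * qPochInf (c * r) q * qPochInf (d * r) q) * qPochInf (q * α) q) := by
    rw [hκ, ← hqa]
    simp only [qPochsInf, List.map_cons, List.map_nil, List.prod_cons, List.prod_nil, mul_one,
      mul_assoc]
  have hκ0 : κ ≠ 0 := by
    have hπ : (π : ℂ) ≠ 0 := by exact_mod_cast Real.pi_ne_zero
    rw [hκ']
    refine div_ne_zero (mul_ne_zero (mul_ne_zero two_ne_zero hπ) ?_) ?_ <;> positivity
  -- The factor `(bcdr; q)_∞` in the Nassrallah–Rahman value cancels the one in the denominator of
  -- `C m`; the shifts by `q^{2m}` produce the finite factorials of the series.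
  have hterm : ∀ m : ℕ, (∫ θ in (0 : ℝ)..π,
      C m * nrWeight q (a * q ^ (2 * m)) b c d r (Complex.exp (Complex.I * θ))) =
      κ * evenSeriesTerm q a b c d r α m := fun m => by
    rw [intervalIntegral.integral_const_mul, integral_nrWeight hq0 hq1 (hA m) hb hc hd hr,
      evenSeriesTerm_eq hq hqα, hκ', hC]
    have sh : ∀ x : ℂ, qPochInf x q ≠ 0 → qPoch x q (2 * m) ≠ 0 ∧
        qPochInf (x * q ^ (2 * m)) q = qPochInf x q / qPoch x q (2 * m) := fun x hx => by
      have h := qPochInf_eq_qPoch_mul x hq (2 * m)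
      have h0 : qPoch x q (2 * m) ≠ 0 := left_ne_zero_of_mul (h ▸ hx)
      exact ⟨h0, by rw [eq_div_iff h0, mul_comm, ← h]⟩
    rw [show a * (q : ℂ) ^ (2 * m) * b * c * d = a * b * c * d * q ^ (2 * m) by ring,
      show a * (q : ℂ) ^ (2 * m) * b * c * r = a * b * c * r * q ^ (2 * m) by ring,
      show a * (q : ℂ) ^ (2 * m) * b * d * r = a * b * d * r * q ^ (2 * m) by ring,
      show a * (q : ℂ) ^ (2 * m) * c * d * r = a * c * d * r * q ^ (2 * m) by ring,
      show a * (q : ℂ) ^ (2 * m) * b = a * b * q ^ (2 * m) by ring,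
      show a * (q : ℂ) ^ (2 * m) * c = a * c * q ^ (2 * m) by ring,
      show a * (q : ℂ) ^ (2 * m) * d = a * d * q ^ (2 * m) by ring,
      show a * (q : ℂ) ^ (2 * m) * r = a * r * q ^ (2 * m) by ring,
      (sh _ m1).2, (sh _ m2).2, (sh _ m3).2, (sh _ m4).2, (sh _ n1).2, (sh _ n2).2, (sh _ n3).2,
      (sh _ n4).2]
    have k1 := (sh _ m1).1; have k2 := (sh _ m2).1; have k3 := (sh _ m3).1
    have k4 := (sh _ m4).1; have k5 := (sh _ n1).1; have k6 := (sh _ n2).1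
    have k7 := (sh _ n3).1; have k8 := (sh _ n4).1
    clear sh
    dsimp only
    rw [← hsdef]
    generalize qPochInf (a * b * c * d) q = x1 at *
    generalize qPochInf (a * b * c * r) q = x2 at *
    generalize qPochInf (a * b * d * r) q = x3 at *
    generalize qPochInf (a * c * d * r) q = x4 at *
    generalize qPochInf (a * b) q = x5 at *
    generalize qPochInf (a * c) q = x6 at *
    generalize qPochInf (a * d) q = x7 at *
    generalize qPochInf (a * r) q = x8 at *
    generalize qPoch (a * b * c * d) q (2 * m) = y1 at *
    generalize qPoch (a * b * c * r) q (2 * m) = y2 at *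
    generalize qPoch (a * b * d * r) q (2 * m) = y3 at *
    generalize qPoch (a * c * d * r) q (2 * m) = y4 at *
    generalize qPoch (a * b) q (2 * m) = y5 at *
    generalize qPoch (a * c) q (2 * m) = y6 at *
    generalize qPoch (a * d) q (2 * m) = y7 at *
    generalize qPoch (a * r) q (2 * m) = y8 at *
    generalize qPochInf (q * α) q = x9 at *
    generalize qPochInf s q = x10 at *
    field_simp
  simp_rw [hterm] at hint
  -- The termwise integrals are already summable, and `κ ≠ 0` lets the constant be divided out.
  have hes : Summable (evenSeriesTerm q a b c d r α) := (summable_mul_left_iff hκ0).1 hint.summable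
  refine ⟨fun θ => ?_, hwcont.intervalIntegrable _ _, hes, ?_⟩
  · obtain ⟨V, h1, -⟩ := exists_hasSum_bailey (x := a * Complex.exp (Complex.I * θ))
      (y := a * Complex.exp (-(Complex.I * θ))) (s := s) hqc hq hα1 hqα hs (by
        rw [hqa, hsdef, Complex.exp_neg]
        have := Complex.exp_ne_zero (Complex.I * θ)
        field_simp)
    exact (summable_congr fun n => qHyperTerm_sqrt hσ _ _ _ n).2 h1.summable
  · rw [← tsum_mul_left, hint.tsum_eq]
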